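/- **Setting.** Let $i\ge 2$ be an integer and $\alpha\in(0,\pi/2]$. The $i$-Fibonacci words over $\{0,1\}$ are $f^{[i]}_1=0$, $f^{[i]}_2=0^{i-1}1$, $f^{[i]}_n=f^{[i]}_{n-1}f^{[i]}_{n-2}$ for $n\ge 3$. The curve $\mathcal F^{[i]}_n\subset\mathbb R^2=\mathbb C$ is drawn from $f^{[i]}_n=a_1a_2\cdots$ as follows: start at the origin in direction $\pi/2$; for $j=1,2,\dots$ draw a unit segment in the current direction and then, if $a_j=0$, turn left by $\alpha$ when $j$ is even and right by $\alpha$ when $j$ is odd (do not turn if $a_j=1$). Let $w^{[i]}_n$ be the distance between the first and last vertices of $\mathcal F^{[i]}_n$, and put $n_k=6k+4$ if $i$ is even and $n_k=6k+2$ if $i$ is odd. Let $$R=\Big((1+\cos\alpha)+\sqrt{(1+\cos\alpha)^2+1}\Big)^{-1},\qquad \theta=\begin{cases}\pi/2-\alpha,& i\text{ even},\\ \pi/2-\alpha/2,& i\text{ odd},\end{cases}\qquad s=\sqrt2\,e^{\mathrm i\theta}.$$ (Thus the odd case is the even case rotated about the origin by $\alpha/2$, which is $\pi/4$ when $\alpha=\pi/2$.)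 For $p\ne q$ in $\mathbb C$ let $T(p,q)$ be the isosceles trapezoid with longer base $[p,q]$, lying to the left of the vector from $p$ to $q$, with angles $\alpha$ at this base and legs of length $\frac{R}{1-R}|q-p|$ (a rectangle if $\alpha=\pi/2$). Let $$P_0=0,\quad P_1=sRe^{\mathrm i\alpha},\quad P_2=P_1+sR,\quad P_3=P_2+sR^2,\quad P_4=P_3+sR,\quad P_5=P_4+sRe^{-\mathrm i\alpha}=s.$$ The large trapezoid is $T(0,s)$ and the five small ones are $T(P_1,P_0)$, $T(P_1,P_2)$, $T(P_2,P_3)$, $T(P_3,P_4)$, $T(P_5,P_4)$. A *trapezoid IFS* is a family of five contractive similarities $\phi_1,\dots,\phi_5$ of the plane such that $\phi_k$ maps the large trapezoid onto the $k$-th small one and the base $[0,s]$ onto the longer base of the $k$-th small one. An *attractor* of it is a nonempty compact set $K$ with $K=\bigcup_{k=1}^5\phi_k(K)$. **Theorem.** For every $i\ge2$ and $\alpha\in(0,\pi/2]$: 1. The five maps $\phi_1(z)=P_1-Re^{\mathrm i\alpha}z$, $\phi_2(z)=P_1+Rz$, $\phi_3(z)=P_2+R^2z$, $\phi_4(z)=P_3+Rz$,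 $\phi_5(z)=P_5-Re^{-\mathrm i\alpha}z$ form a trapezoid IFS. 2. The scaled curves $\frac{\sqrt2}{w^{[i]}_{n_k}}\mathcal F^{[i]}_{n_k}$ converge as $k\to\infty$, in the Hausdorff metric, to a nonempty compact set $\mathcal F^{[i]}_\alpha$, and for every trapezoid IFS the set $\mathcal F^{[i]}_\alpha$ is its unique attractor. -/

import Mathlib

open Filter Topology

noncomputable section

/-- The `i`-Fibonacci words over the alphabet `{0, 1}`: `f₁ = 0`, `f₂ = 0^{i-1} 1` and
`f_n = f_{n-1} f_{n-2}` for `n ≥ 3`.  (The value at `n = 0` is a placeholder.) -/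
def fibWord (i : ℕ) : ℕ → List (Fin 2)
  | 0 => []
  | 1 => [0]
  | 2 => List.replicate (i - 1) 0 ++ [1]
  | n + 3 => fibWord i (n + 2) ++ fibWord i (n + 1)

/-- The drawing direction after the first `j` letters of `w` have been processed with drawing
angle `α`.  The initial direction is `π / 2`.  The letter number `j + 1` (letters are numbered
from `1`) turns left by `α` if it is a `0` and `j + 1` is even, turns right by `α` if it is a `0`
and `j + 1` is odd, and does not turn if it is a `1`. -/
def drawDir (α : ℝ) (w : List (Fin 2)) : ℕ → ℝ
  | 0 => Real.pi / 2
  | j + 1 =>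
      drawDir α w j + (if w.getD j 1 = 0 then (if Even (j + 1) then α else -α) else 0)

/-- The `j`-th vertex of the curve drawn from `w`: each letter draws a unit segment in the
current direction (and then turns), starting at the origin. -/
def drawVertex (α : ℝ) (w : List (Fin 2)) : ℕ → ℂ
  | 0 => 0
  | j + 1 => drawVertex α w j + Complex.exp (drawDir α w j * Complex.I)

/-- The curve drawn from `w`, as a subset of the plane: one segment for each letter. -/
def drawCurve (α : ℝ) (w : List (Fin 2)) : Set ℂ :=
  ⋃ j ∈ Finset.range w.length, segment ℝ (drawVertex α w j) (drawVertex α w (j + 1))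

/-- The width of the curve: the distance between its first and its last vertex. -/
def drawWidth (α : ℝ) (w : List (Fin 2)) : ℝ :=
  dist (drawVertex α w 0) (drawVertex α w w.length)

/-- The curve of `w` rescaled so that its first and last vertices are at distance `√2`. -/
def scaledCurve (α : ℝ) (w : List (Fin 2)) : Set ℂ :=
  (fun z : ℂ => ((Real.sqrt 2 / drawWidth α w : ℝ) : ℂ) * z) '' drawCurve α w

/-- The subsequence along which the scaling limit is taken. -/
def fibIndex (i k : ℕ) : ℕ := if Even i then 6 * k + 4 else 6 * k + 2

/-- `F` is the scaling limit of the `i`-Fibonacci curves with drawing angle `α`: the limit, in the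
space of nonempty compact subsets of the plane with the Hausdorff distance, of the rescaled
curves along the subsequence `fibIndex i`. -/
def IsScalingLimit (i : ℕ) (α : ℝ) (F : Set ℂ) : Prop :=
  F.Nonempty ∧ IsCompact F ∧
    Tendsto (fun k => Metric.hausdorffEDist (scaledCurve α (fibWord i (fibIndex i k))) F)
      atTop (𝓝 0)

/-- The scaling ratio `R`. -/
def ratioR (α : ℝ) : ℝ :=
  ((1 + Real.cos α) + Real.sqrt ((1 + Real.cos α) ^ 2 + 1))⁻¹

/-- The unit vector along the base of the large trapezoid.  The odd case is the even case turned
counterclockwise by `α / 2`, which is `π / 4` for `α = π / 2`. -/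
def baseDir (i : ℕ) (α : ℝ) : ℂ :=
  Complex.exp (((if Even i then Real.pi / 2 - α else Real.pi / 2 - α / 2 : ℝ) : ℂ) * Complex.I)

/-- The isosceles trapezoid with longer base from `p` to `q`, lying to the left of the vector
from `p` to `q`, with angles `α` at this base and with legs `R / (1 - R)` times as long as
this base.  (For `α = π / 2` it is a rectangle with sides in proportion `√2 : 1`.) -/
def trapezoid (α : ℝ) (p q : ℂ) : Set ℂ :=
  convexHull ℝ
    {p, q,
      p + (q - p) * (((ratioR α / (1 - ratioR α) : ℝ) : ℂ) * Complex.exp ((α : ℂ) * Complex.I)),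
      q - (q - p) * (((ratioR α / (1 - ratioR α) : ℝ) : ℂ) * Complex.exp (-(α : ℂ) * Complex.I))}

/-- The vertices `P 0, …, P 5` of the polygonal line formed by the longer bases of the five small
trapezoids.  Its steps have lengths `√2 R, √2 R, √2 R², √2 R, √2 R` and make the angles
`α, 0, 0, 0, -α` with the base of the large trapezoid; it runs from `0` to `√2 · baseDir i α`. -/
def pathVertex (i : ℕ) (α : ℝ) : Fin 6 → ℂ :=
  let s : ℂ := (Real.sqrt 2 : ℂ) * baseDir i α
  let R : ℂ := (ratioR α : ℂ)
  let e : ℂ := Complex.exp ((α : ℂ) * Complex.I)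
  let e' : ℂ := Complex.exp (-(α : ℂ) * Complex.I)
  ![0,
    s * (R * e),
    s * (R * e + R),
    s * (R * e + R + R ^ 2),
    s * (R * e + R + R ^ 2 + R),
    s * (R * e + R + R ^ 2 + R + R * e')]

/-- Starting points of the longer bases of the five small trapezoids; the bases are directed so
that the trapezoid lies on their left. -/
def baseStart (i : ℕ) (α : ℝ) : Fin 5 → ℂ :=
  ![pathVertex i α 1, pathVertex i α 1, pathVertex i α 2, pathVertex i α 3, pathVertex i α 5]

/-- End points of the longer bases of the five small trapezoids. -/
def baseEnd (i : ℕ) (α : ℝ) : Fin 5 → ℂ :=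
  ![pathVertex i α 0, pathVertex i α 2, pathVertex i α 3, pathVertex i α 4, pathVertex i α 4]

/-- A contractive similarity of the plane. -/
def IsContractiveSimilarity (φ : ℂ → ℂ) : Prop :=
  ∃ r : ℝ, 0 < r ∧ r < 1 ∧ ∀ x y, dist (φ x) (φ y) = r * dist x y

/-- The five maps are contractive similarities which carry the large trapezoid onto the five small
ones, and the base of the large trapezoid onto the longer bases of the small ones. -/
def IsTrapezoidIFS (i : ℕ) (α : ℝ) (φ : Fin 5 → ℂ → ℂ) : Prop :=
  ∀ k, IsContractiveSimilarity (φ k) ∧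
    φ k '' trapezoid α 0 ((Real.sqrt 2 : ℂ) * baseDir i α) =
      trapezoid α (baseStart i α k) (baseEnd i α k) ∧
    φ k '' segment ℝ 0 ((Real.sqrt 2 : ℂ) * baseDir i α) =
      segment ℝ (baseStart i α k) (baseEnd i α k)

/-- Linear parts of the five orientation-preserving maps. -/
def fibCoeff (α : ℝ) : Fin 5 → ℂ :=
  let R : ℂ := (ratioR α : ℂ)
  let e : ℂ := Complex.exp ((α : ℂ) * Complex.I)
  let e' : ℂ := Complex.exp (-(α : ℂ) * Complex.I)
  ![-(R * e), R, R ^ 2, R, -(R * e')]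

/-- The five maps, in their orientation-preserving version. -/
def fibMap (i : ℕ) (α : ℝ) (k : Fin 5) (z : ℂ) : ℂ :=
  baseStart i α k + fibCoeff α k * z

/-- `F` is an attractor of the iterated function system `φ`: a nonempty compact set with
`F = ⋃ k, φ k '' F`. -/
def IsAttractor (φ : Fin 5 → ℂ → ℂ) (F : Set ℂ) : Prop :=
  F.Nonempty ∧ IsCompact F ∧ F = ⋃ k, φ k '' F

end

/-! The curves satisfy, up to bounded errors, the same five-piece recursion as the attractor, and
this recursion contracts errors after rescaling.

Words: with b a base index, `fibWord_baseIndex_add_two` gives f_{b+6} = f_{b+3} f_{b+3} f_b s s,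
where s = f_{b+1} f_{b+2} is f_{b+3} with its factors exchanged. Exchanging the factors moves the
curve by a bounded amount only (`exists_hausdorffClose_swap`). So a curve consists of four copies of
its predecessor and one copy of the curve before that, up to errors that vanish after rescaling.

Geometry: reading a word acts on what follows by an isometry (`placement`). Along the base indices
this isometry is a glide reflection whose linear part is constant, and the endpoints equal an
alternating unit direction times Y m, plus a constant (`exists_fibEnd_eq`). Here Y (m+2) = 2(1 + cos
α) Y (m+1) + Y m, so Y m / Y (m+1) tends to R, the positive root of R² + 2(1 + cos α)R = 1.
Reflecting every second curve (`align`) removes the alternation, and the rescaled pieces then start,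
in the limit, at the vertices of the path (`tendsto_pieceStart`).

Convergence: the Hausdorff error e satisfies e (m+2) ≤ r e (m+1) + r' e m + o(1) with r → R and r' →
R², where R < 1/2; hence e → 0 (`exists_hausdorffClose_tendsto_zero`).

All systems at once: a map of a trapezoid IFS is either `fibMap` or `fibMap` preceded by the
reflection in the axis of the large trapezoid (`IsTrapezoidIFS.eq_or_eq`). That reflection permutes
the maps `fibMap`, so it preserves their attractor (`IsAttractor.image_baseReflection`), and the
choice does not matter. -/

open Filter Topology

noncomputable section

/-! ### Hausdorff closeness of plane sets -/

/-- Every point of either set is within distance `r` of the other set. -/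
def HausdorffClose (r : ℝ) (X Y : Set ℂ) : Prop :=
  (∀ x ∈ X, ∃ y ∈ Y, dist x y ≤ r) ∧ (∀ y ∈ Y, ∃ x ∈ X, dist x y ≤ r)

namespace HausdorffClose

variable {r r' : ℝ} {X Y Z X' Y' : Set ℂ}

theorem refl (X : Set ℂ) : HausdorffClose 0 X X :=
  ⟨fun x hx => ⟨x, hx, by simp⟩, fun x hx => ⟨x, hx, by simp⟩⟩

theorem mono (h : HausdorffClose r X Y) (hr : r ≤ r') : HausdorffClose r' X Y :=
  ⟨fun x hx => (h.1 x hx).imp fun _ hy => ⟨hy.1, hy.2.trans hr⟩,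
    fun x hx => (h.2 x hx).imp fun _ hy => ⟨hy.1, hy.2.trans hr⟩⟩

theorem symm (h : HausdorffClose r X Y) : HausdorffClose r Y X :=
  ⟨fun x hx => (h.2 x hx).imp fun _ hy => ⟨hy.1, by rw [dist_comm]; exact hy.2⟩,
    fun x hx => (h.1 x hx).imp fun _ hy => ⟨hy.1, by rw [dist_comm]; exact hy.2⟩⟩

theorem trans (h : HausdorffClose r X Y) (h' : HausdorffClose r' Y Z) :
    HausdorffClose (r + r') X Z := by
  constructor
  · intro x hx
    obtain ⟨y, hy, hxy⟩ := h.1 x hx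
    obtain ⟨z, hz, hyz⟩ := h'.1 y hy
    exact ⟨z, hz, (dist_triangle x y z).trans (add_le_add hxy hyz)⟩
  · intro z hz
    obtain ⟨y, hy, hyz⟩ := h'.2 z hz
    obtain ⟨x, hx, hxy⟩ := h.2 y hy
    exact ⟨x, hx, (dist_triangle x y z).trans (add_le_add hxy hyz)⟩

theorem union (h : HausdorffClose r X Y) (h' : HausdorffClose r X' Y') :
    HausdorffClose r (X ∪ X') (Y ∪ Y') := by
  constructor
  · rintro x (hx | hx)
    · exact (h.1 x hx).imp fun _ hy => ⟨Or.inl hy.1, hy.2⟩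
    · exact (h'.1 x hx).imp fun _ hy => ⟨Or.inr hy.1, hy.2⟩
  · rintro x (hx | hx)
    · exact (h.2 x hx).imp fun _ hy => ⟨Or.inl hy.1, hy.2⟩
    · exact (h'.2 x hx).imp fun _ hy => ⟨Or.inr hy.1, hy.2⟩

theorem iUnion {ι : Type*} {S T : ι → Set ℂ} (h : ∀ k, HausdorffClose r (S k) (T k)) :
    HausdorffClose r (⋃ k, S k) (⋃ k, T k) := by
  constructor
  · intro x hx
    obtain ⟨k, hk⟩ := Set.mem_iUnion.1 hx
    exact ((h k).1 x hk).imp fun _ hy => ⟨Set.mem_iUnion.2 ⟨k, hy.1⟩, hy.2⟩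
  · intro x hx
    obtain ⟨k, hk⟩ := Set.mem_iUnion.1 hx
    exact ((h k).2 x hk).imp fun _ hy => ⟨Set.mem_iUnion.2 ⟨k, hy.1⟩, hy.2⟩

theorem image₂ {f g : ℂ → ℂ} (h : HausdorffClose r X Y)
    (hfg : ∀ x ∈ X, ∀ y ∈ Y, dist x y ≤ r → dist (f x) (g y) ≤ r') :
    HausdorffClose r' (f '' X) (g '' Y) := by
  constructor
  · rintro _ ⟨x, hx, rfl⟩
    obtain ⟨y, hy, hxy⟩ := h.1 x hx
    exact ⟨g y, ⟨y, hy, rfl⟩, hfg x hx y hy hxy⟩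
  · rintro _ ⟨y, hy, rfl⟩
    obtain ⟨x, hx, hxy⟩ := h.2 y hy
    exact ⟨f x, ⟨x, hx, rfl⟩, hfg x hx y hy hxy⟩

theorem image {f : ℂ → ℂ} {q : ℝ} (hq : 0 ≤ q) (hf : ∀ x y, dist (f x) (f y) ≤ q * dist x y)
    (h : HausdorffClose r X Y) : HausdorffClose (q * r) (f '' X) (f '' Y) :=
  h.image₂ fun x _ y _ hxy => (hf x y).trans (mul_le_mul_of_nonneg_left hxy hq)

theorem hausdorffEDist_le (h : HausdorffClose r X Y) :
    Metric.hausdorffEDist X Y ≤ ENNReal.ofReal r := by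
  refine Metric.hausdorffEDist_le_of_mem_edist ?_ ?_
  · intro x hx
    obtain ⟨y, hy, hxy⟩ := h.1 x hx
    exact ⟨y, hy, by rw [edist_dist]; exact ENNReal.ofReal_le_ofReal hxy⟩
  · intro x hx
    obtain ⟨y, hy, hxy⟩ := h.2 x hx
    exact ⟨y, hy, by rw [edist_dist, dist_comm]; exact ENNReal.ofReal_le_ofReal hxy⟩

end HausdorffClose

theorem hausdorffClose_hausdorffDist {X Y : Set ℂ} (hX : IsCompact X) (hX0 : X.Nonempty)
    (hY : IsCompact Y) (hY0 : Y.Nonempty) :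
    HausdorffClose (Metric.hausdorffDist X Y) X Y := by
  have fin : Metric.hausdorffEDist X Y ≠ ⊤ :=
    Metric.hausdorffEDist_ne_top_of_nonempty_of_bounded hX0 hY0 hX.isBounded hY.isBounded
  constructor
  · intro x hx
    obtain ⟨y, hy, hxy⟩ := hY.exists_infDist_eq_dist hY0 x
    exact ⟨y, hy, hxy ▸ Metric.infDist_le_hausdorffDist_of_mem hx fin⟩
  · intro y hy
    obtain ⟨x, hx, hxy⟩ := hX.exists_infDist_eq_dist hX0 y
    refine ⟨x, hx, ?_⟩
    rw [dist_comm, ← hxy, Metric.hausdorffDist_comm]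
    exact Metric.infDist_le_hausdorffDist_of_mem hy (Metric.hausdorffEDist_comm (s := X) ▸ fin)

/-! ### Existence and uniqueness of attractors -/

/-- A family of maps is contracting if its members share a Lipschitz constant below `1`. -/
theorem exists_contraction_ratio {φ : Fin 5 → ℂ → ℂ} (h : ∀ k, IsContractiveSimilarity (φ k)) :
    ∃ q : ℝ, 0 ≤ q ∧ q < 1 ∧ ∀ k x y, dist (φ k x) (φ k y) ≤ q * dist x y := by
  choose r hr0 hr1 hr using h
  obtain ⟨k₀, -, hk₀⟩ := Finset.exists_max_image Finset.univ r Finset.univ_nonempty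
  refine ⟨r k₀, (hr0 k₀).le, hr1 k₀, fun k x y => ?_⟩
  rw [hr k]
  exact mul_le_mul_of_nonneg_right (hk₀ k (Finset.mem_univ k)) dist_nonneg

/-- Applying the system to both sets multiplies their distance by q < 1 and leaves both unchanged,
so the distance is zero. -/
theorem IsAttractor.unique {φ : Fin 5 → ℂ → ℂ} (h : ∀ k, IsContractiveSimilarity (φ k))
    {F G : Set ℂ} (hF : IsAttractor φ F) (hG : IsAttractor φ G) : G = F := by
  obtain ⟨q, hq0, hq1, hq⟩ := exists_contraction_ratio h
  obtain ⟨hF0, hFc, hFe⟩ := hF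
  obtain ⟨hG0, hGc, hGe⟩ := hG
  have key : ∀ r, HausdorffClose r G F → HausdorffClose (q * r) G F := by
    intro r hr
    rw [hFe, hGe]
    exact HausdorffClose.iUnion fun k => hr.image hq0 (hq k)
  have h0 := hausdorffClose_hausdorffDist hGc hG0 hFc hF0
  have hn : ∀ n : ℕ, HausdorffClose (q ^ n * Metric.hausdorffDist G F) G F := by
    intro n
    induction n with
    | zero => simpa using h0
    | succ n ih => simpa [pow_succ', mul_assoc] using key _ ih
  have hz : Metric.hausdorffEDist G F = 0 := by
    have hlim : Tendsto (fun n : ℕ => ENNReal.ofReal (q ^ n * Metric.hausdorffDist G F)) atTop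
        (𝓝 (ENNReal.ofReal (0 * Metric.hausdorffDist G F))) :=
      (ENNReal.continuous_ofReal.tendsto _).comp
        ((tendsto_pow_atTop_nhds_zero_of_lt_one hq0 hq1).mul_const _)
    have := ge_of_tendsto' hlim fun n => (hn n).hausdorffEDist_le
    simpa using this
  exact (IsClosed.hausdorffEDist_zero_iff hGc.isClosed hFc.isClosed).1 hz

/-- Hutchinson's argument: the union of the images is a contraction of the complete space of
nonempty compact sets, and Banach's theorem gives a fixed point. -/
theorem exists_isAttractor {φ : Fin 5 → ℂ → ℂ} (h : ∀ k, IsContractiveSimilarity (φ k)) :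
    ∃ F, IsAttractor φ F := by
  obtain ⟨q, hq0, hq1, hq⟩ := exists_contraction_ratio h
  have hcont : ∀ k, Continuous (φ k) := fun k =>
    (LipschitzWith.of_dist_le_mul (K := ⟨q, hq0⟩) (hq k)).continuous
  let T : TopologicalSpace.NonemptyCompacts ℂ → TopologicalSpace.NonemptyCompacts ℂ := fun K =>
    ⟨⟨⋃ k, φ k '' K, isCompact_iUnion fun k => K.isCompact.image (hcont k)⟩,
      Set.nonempty_iUnion.2 ⟨0, K.nonempty.image _⟩⟩
  have hT : ContractingWith ⟨q, hq0⟩ T := by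
    refine ⟨by exact_mod_cast hq1, LipschitzWith.of_dist_le_mul fun K L => ?_⟩
    rw [Metric.NonemptyCompacts.dist_eq, Metric.NonemptyCompacts.dist_eq]
    have hc : HausdorffClose (q * Metric.hausdorffDist (K : Set ℂ) L) (T K) (T L) :=
      HausdorffClose.iUnion fun k =>
        (hausdorffClose_hausdorffDist K.isCompact K.nonempty L.isCompact L.nonempty).image hq0 (hq k)
    exact ENNReal.toReal_le_of_le_ofReal (mul_nonneg hq0 Metric.hausdorffDist_nonneg)
      hc.hausdorffEDist_le
  have := TopologicalSpace.NonemptyCompacts.instCompleteSpace (α := ℂ)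
  let K := ContractingWith.fixedPoint T hT
  have hK : T K = K := ContractingWith.fixedPoint_isFixedPt hT
  exact ⟨K, K.nonempty, K.isCompact,
    congrArg (fun L : TopologicalSpace.NonemptyCompacts ℂ => (L : Set ℂ)) hK.symm⟩

/-! ### The ratio R and the symmetries of a trapezoid -/

theorem ratioR_pos {α : ℝ} : 0 < ratioR α := by
  have h : |1 + Real.cos α| < Real.sqrt ((1 + Real.cos α) ^ 2 + 1) :=
    Real.lt_sqrt_of_sq_lt (by rw [sq_abs]; linarith)
  have := neg_abs_le (1 + Real.cos α)
  exact inv_pos.2 (by linarith)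

/-- This one equation serves twice: it closes the path of small bases (`pathVertex_last`), and it is
the characteristic equation of the endpoint recurrence. -/
theorem ratioR_eq (α : ℝ) : ratioR α ^ 2 + 2 * (1 + Real.cos α) * ratioR α = 1 := by
  have h0 : (0 : ℝ) < ratioR α := ratioR_pos
  have h := Real.sq_sqrt (show (0 : ℝ) ≤ (1 + Real.cos α) ^ 2 + 1 by positivity)
  have hR : ratioR α * ((1 + Real.cos α) + Real.sqrt ((1 + Real.cos α) ^ 2 + 1)) = 1 :=
    inv_mul_cancel₀ (fun h' => by simp [ratioR, h'] at h0)
  set w := Real.sqrt ((1 + Real.cos α) ^ 2 + 1)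
  have hw : ratioR α = w - (1 + Real.cos α) := by
    linear_combination (w - (1 + Real.cos α)) * hR - ratioR α * h
  rw [hw]
  linear_combination h

theorem ratioR_le_half {α : ℝ} (hc : 0 ≤ Real.cos α) : ratioR α ≤ 1 / 2 := by
  have h0 : (0 : ℝ) < ratioR α := ratioR_pos
  nlinarith [ratioR_eq α, mul_nonneg hc h0.le]

/-- The affine map `z ↦ p + c * z`. -/
def mulAffine (p c : ℂ) : ℂ →ᵃ[ℝ] ℂ :=
  AffineMap.const ℝ ℂ p + (LinearMap.mulLeft ℝ c).toAffineMap

@[simp] theorem mulAffine_apply (p c z : ℂ) : mulAffine p c z = p + c * z := by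
  simp [mulAffine]

/-- The affine map `z ↦ p + c * conj z`. -/
def conjAffine (p c : ℂ) : ℂ →ᵃ[ℝ] ℂ :=
  AffineMap.const ℝ ℂ p +
    (LinearMap.mulLeft ℝ c ∘ₗ Complex.conjAe.toLinearMap).toAffineMap

@[simp] theorem conjAffine_apply (p c z : ℂ) :
    conjAffine p c z = p + c * (starRingEnd ℂ) z := by
  simp [conjAffine]

theorem trapezoid_eq_image (α : ℝ) (p q : ℂ) :
    trapezoid α p q = (fun z => p + (q - p) * z) '' trapezoid α 0 1 := by
  have h : (fun z => p + (q - p) * z) = mulAffine p (q - p) := by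
    funext z; simp
  rw [h, trapezoid, trapezoid, AffineMap.image_convexHull]
  congr 1
  simp only [Set.image_insert_eq, Set.image_singleton, mulAffine_apply]
  congr 1
  · ring
  congr 1
  · ring
  congr 1
  · ring
  congr 1
  ring

theorem segment_eq_image_mul (p q : ℂ) :
    segment ℝ p q = (fun z => p + (q - p) * z) '' segment ℝ 0 1 := by
  have h : (fun z => p + (q - p) * z) = mulAffine p (q - p) := by
    funext z; simp
  rw [h, image_segment]
  simp

theorem image_reflection_trapezoid (α : ℝ) :
    (fun z => 1 - (starRingEnd ℂ) z) '' trapezoid α 0 1 = trapezoid α 0 1 := by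
  have h : (fun z => 1 - (starRingEnd ℂ) z) = conjAffine 1 (-1) := by
    funext z; simp [sub_eq_add_neg]
  have e1 : (starRingEnd ℂ) (Complex.exp (α * Complex.I)) = Complex.exp (-α * Complex.I) := by
    rw [← Complex.exp_conj]; simp
  have e2 : (starRingEnd ℂ) (Complex.exp (-α * Complex.I)) = Complex.exp (α * Complex.I) := by
    rw [← Complex.exp_conj]; simp
  rw [h, trapezoid, AffineMap.image_convexHull]
  congr 1
  simp only [Set.image_insert_eq, Set.image_singleton, conjAffine_apply, map_zero, map_one,
    map_add, map_sub, map_mul, e1, e2, Complex.conj_ofReal]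
  ext z
  simp only [Set.mem_insert_iff, Set.mem_singleton_iff]
  ring_nf
  tauto

theorem trapezoid_im_nonneg {α : ℝ} (hα : 0 < α) (hα' : α ≤ Real.pi / 2) {z : ℂ}
    (hz : z ∈ trapezoid α 0 1) : 0 ≤ z.im := by
  have hR : 0 ≤ ratioR α / (1 - ratioR α) := by
    have := ratioR_le_half (Real.cos_nonneg_of_neg_pi_div_two_le_of_le (by linarith) hα')
    exact div_nonneg ratioR_pos.le (by linarith)
  have hs : 0 ≤ Real.sin α := Real.sin_nonneg_of_nonneg_of_le_pi hα.le (by linarith [Real.pi_pos])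
  refine convexHull_min (t := {w : ℂ | 0 ≤ w.im}) ?_ (convex_halfSpace_im_ge 0) hz
  have e : Complex.exp (-(α : ℂ) * Complex.I) = Complex.exp (((-α : ℝ) : ℂ) * Complex.I) := by simp
  rintro w (rfl | rfl | rfl | rfl)
  · simp
  · simp
  · simp only [zero_add, sub_zero, one_mul, Set.mem_ofPred_eq, Complex.im_ofReal_mul,
      Complex.exp_ofReal_mul_I_im]
    positivity
  · simp only [e, sub_zero, one_mul, Set.mem_ofPred_eq, Complex.im_ofReal_mul, Complex.sub_im,
      Complex.exp_ofReal_mul_I_im, Complex.one_im, Real.sin_neg]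
    nlinarith [mul_nonneg hR hs]

theorem exists_mem_trapezoid_im_pos {α : ℝ} (hα : 0 < α) (hα' : α ≤ Real.pi / 2) :
    ∃ w ∈ trapezoid α 0 1, 0 < w.im := by
  have hR : 0 < ratioR α / (1 - ratioR α) := by
    have := ratioR_le_half (Real.cos_nonneg_of_neg_pi_div_two_le_of_le (by linarith) hα')
    exact div_pos ratioR_pos (by linarith)
  have hs : 0 < Real.sin α := Real.sin_pos_of_pos_of_lt_pi hα (by linarith [Real.pi_pos])
  refine ⟨_, subset_convexHull ℝ _ (Or.inr (Or.inr (Or.inl rfl))), ?_⟩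
  simp only [zero_add, sub_zero, one_mul, Complex.im_ofReal_mul, Complex.exp_ofReal_mul_I_im]
  positivity

/-- The squared distances to 0 and to 1 determine the real part and the square of the imaginary
part. -/
theorem re_eq_im_sq_eq_of_isometry {ψ : ℂ → ℂ} (hψ : ∀ x y, dist (ψ x) (ψ y) = dist x y)
    (h0 : ψ 0 = 0) (h1 : ψ 1 = 1) (z : ℂ) : (ψ z).re = z.re ∧ (ψ z).im ^ 2 = z.im ^ 2 := by
  have a0 := congrArg (· ^ 2) (hψ z 0)
  have a1 := congrArg (· ^ 2) (hψ z 1)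
  simp only [h0, h1, Complex.dist_eq, Complex.sq_norm, Complex.normSq_apply, Complex.sub_re,
    Complex.sub_im, Complex.zero_re, Complex.zero_im, Complex.one_re, Complex.one_im] at a0 a1
  constructor <;> nlinarith

/-- The remaining sign ambiguity is settled by a point w of the trapezoid off the real axis: its
image stays in the upper half-plane, so w is fixed, and the distance to w fixes the sign everywhere.
-/
theorem eq_id_of_isometry_of_trapezoid {α : ℝ} (hα : 0 < α) (hα' : α ≤ Real.pi / 2) {ψ : ℂ → ℂ}
    (hψ : ∀ x y, dist (ψ x) (ψ y) = dist x y) (h0 : ψ 0 = 0) (h1 : ψ 1 = 1)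
    (hT : ψ '' trapezoid α 0 1 = trapezoid α 0 1) (z : ℂ) : ψ z = z := by
  obtain ⟨w, hw, hwi⟩ := exists_mem_trapezoid_im_pos hα hα'
  have hψw := trapezoid_im_nonneg hα hα' (hT ▸ Set.mem_image_of_mem ψ hw)
  have key := re_eq_im_sq_eq_of_isometry hψ h0 h1
  have hwim : (ψ w).im = w.im := (sq_eq_sq₀ hψw hwi.le).1 (key w).2
  have a := congrArg (· ^ 2) (hψ z w)
  simp only [Complex.dist_eq, Complex.sq_norm, Complex.normSq_apply, Complex.sub_re,
    Complex.sub_im, hwim, (key w).1, (key z).1] at a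
  refine Complex.ext (key z).1 ?_
  have : w.im * (ψ z).im = w.im * z.im := by nlinarith [(key z).2]
  exact mul_left_cancel₀ hwi.ne' this

theorem mem_segment_zero_one {z : ℂ} (hz : z ∈ segment ℝ (0 : ℂ) 1) :
    0 ≤ z.re ∧ z.re ≤ 1 ∧ z.im = 0 := by
  obtain ⟨a, b, ha, hb, hab, rfl⟩ := hz
  simp
  constructor <;> linarith

theorem dist_le_one_of_mem_segment {z w : ℂ} (hz : z ∈ segment ℝ (0 : ℂ) 1)
    (hw : w ∈ segment ℝ (0 : ℂ) 1) : dist z w ≤ 1 := by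
  obtain ⟨hz0, hz1, hz2⟩ := mem_segment_zero_one hz
  obtain ⟨hw0, hw1, hw2⟩ := mem_segment_zero_one hw
  have : z - w = ((z.re - w.re : ℝ) : ℂ) := Complex.ext (by simp) (by simp [hz2, hw2])
  rw [Complex.dist_eq, this, Complex.norm_real, Real.norm_eq_abs, abs_le]
  constructor <;> linarith

theorem endpoints_of_dist_eq_one {z w : ℂ} (hz : z ∈ segment ℝ (0 : ℂ) 1)
    (hw : w ∈ segment ℝ (0 : ℂ) 1) (h : dist z w = 1) : (z = 0 ∧ w = 1) ∨ (z = 1 ∧ w = 0) := by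
  obtain ⟨hz0, hz1, hz2⟩ := mem_segment_zero_one hz
  obtain ⟨hw0, hw1, hw2⟩ := mem_segment_zero_one hw
  have e : z - w = ((z.re - w.re : ℝ) : ℂ) := Complex.ext (by simp) (by simp [hz2, hw2])
  rw [Complex.dist_eq, e, Complex.norm_real, Real.norm_eq_abs] at h
  rcases abs_eq (zero_le_one) |>.1 h with h | h
  · right
    exact ⟨Complex.ext (by simp; linarith) (by simpa), Complex.ext (by simp; linarith) (by simpa)⟩
  · left
    exact ⟨Complex.ext (by simp; linarith) (by simpa), Complex.ext (by simp; linarith) (by simpa)⟩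

theorem eq_id_or_reflection {α : ℝ} (hα : 0 < α) (hα' : α ≤ Real.pi / 2) {ψ : ℂ → ℂ} {r : ℝ}
    (hr : 0 < r) (hψ : ∀ x y, dist (ψ x) (ψ y) = r * dist x y)
    (hS : ψ '' segment ℝ (0 : ℂ) 1 = segment ℝ (0 : ℂ) 1)
    (hT : ψ '' trapezoid α 0 1 = trapezoid α 0 1) :
    (∀ z, ψ z = z) ∨ (∀ z, ψ z = 1 - (starRingEnd ℂ) z) := by
  have m0 : ψ 0 ∈ segment ℝ (0 : ℂ) 1 := hS ▸ Set.mem_image_of_mem ψ (left_mem_segment ℝ _ _)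
  have m1 : ψ 1 ∈ segment ℝ (0 : ℂ) 1 := hS ▸ Set.mem_image_of_mem ψ (right_mem_segment ℝ _ _)
  -- The segment of length 1 is mapped onto itself: the images of its endpoints give r ≤ 1,
  -- preimages of its endpoints give r ≥ 1.
  have hr1 : r = 1 := by
    apply le_antisymm
    · simpa [hψ 0 1] using dist_le_one_of_mem_segment m0 m1
    · obtain ⟨x, hx, hx0⟩ : (0 : ℂ) ∈ ψ '' segment ℝ (0 : ℂ) 1 := by
        rw [hS]; exact left_mem_segment ℝ _ _
      obtain ⟨y, hy, hy0⟩ : (1 : ℂ) ∈ ψ '' segment ℝ (0 : ℂ) 1 := by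
        rw [hS]; exact right_mem_segment ℝ _ _
      have := hψ x y
      rw [hx0, hy0] at this
      simp only [dist_zero_left, norm_one] at this
      nlinarith [dist_le_one_of_mem_segment hx hy]
  subst hr1
  simp only [one_mul] at hψ
  rcases endpoints_of_dist_eq_one m0 m1 (by simp [hψ]) with ⟨h0, h1⟩ | ⟨h0, h1⟩
  · exact Or.inl (eq_id_of_isometry_of_trapezoid hα hα' hψ h0 h1 hT)
  · right
    intro z
    -- If the endpoints are exchanged, composing with the reflection of the trapezoid leads back to
    -- the case where they are fixed.
    have := eq_id_of_isometry_of_trapezoid hα hα' (ψ := fun z => 1 - (starRingEnd ℂ) (ψ z))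
      (fun x y => by
        rw [dist_sub_left, ← hψ x y, Complex.dist_conj_conj]) (by simp [h0]) (by simp [h1])
      (by
        rw [← Set.image_image (fun z => 1 - (starRingEnd ℂ) z) ψ, hT, image_reflection_trapezoid]) z
    have h2 := congrArg (starRingEnd ℂ) this
    simp only [map_sub, map_one, Complex.conj_conj] at h2
    linear_combination -h2

/-! ### Classification of trapezoid systems and symmetry of the attractor -/

/-- The longer base of the large trapezoid, as a complex number. -/
def largeBase (i : ℕ) (α : ℝ) : ℂ := (Real.sqrt 2 : ℂ) * baseDir i α

theorem norm_baseDir (i : ℕ) (α : ℝ) : ‖baseDir i α‖ = 1 := Complex.norm_exp_ofReal_mul_I _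

theorem largeBase_ne_zero (i : ℕ) (α : ℝ) : largeBase i α ≠ 0 := by
  rw [largeBase, mul_ne_zero_iff]
  exact ⟨by simp, Complex.exp_ne_zero _⟩

theorem baseEnd_eq (i : ℕ) (α : ℝ) (k : Fin 5) :
    baseEnd i α k = baseStart i α k + fibCoeff α k * largeBase i α := by
  fin_cases k <;>
    simp [baseEnd, baseStart, fibCoeff, pathVertex, largeBase] <;> ring

theorem norm_fibCoeff_pos (α : ℝ) (k : Fin 5) : 0 < ‖fibCoeff α k‖ := by
  have : ratioR α ≠ 0 := ratioR_pos.ne'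
  fin_cases k <;> simp [fibCoeff, this, sq_pos_iff]

theorem norm_fibCoeff_lt {α : ℝ} (hc : 0 ≤ Real.cos α) (k : Fin 5) : ‖fibCoeff α k‖ < 1 := by
  have h0 : (0 : ℝ) < ratioR α := ratioR_pos
  have h := ratioR_le_half hc
  have e : ‖Complex.exp (-(α : ℂ) * Complex.I)‖ = 1 := by
    have := Complex.norm_exp_ofReal_mul_I (-α)
    simpa using this
  have e1 := Complex.norm_exp_ofReal_mul_I α
  have e2 : ‖(ratioR α : ℂ)‖ < 1 := by
    rw [Complex.norm_real, Real.norm_eq_abs, abs_of_pos h0]; linarith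
  fin_cases k <;> simp only [fibCoeff, Fin.zero_eta, Fin.mk_one, Fin.reduceFinMk,
    Matrix.cons_val, norm_neg, norm_mul, e, e1, mul_one, norm_pow]
  any_goals exact e2
  exact pow_lt_one₀ (norm_nonneg _) e2 (by norm_num)

theorem isContractiveSimilarity_fibMap (i : ℕ) {α : ℝ} (hc : 0 ≤ Real.cos α) (k : Fin 5) :
    IsContractiveSimilarity (fibMap i α k) := by
  refine ⟨‖fibCoeff α k‖, norm_fibCoeff_pos α k, norm_fibCoeff_lt hc k, fun x y => ?_⟩
  rw [fibMap, fibMap, dist_add_left, Complex.dist_eq, Complex.dist_eq, ← mul_sub, norm_mul]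

theorem isTrapezoidIFS_fibMap (i : ℕ) {α : ℝ} (hc : 0 ≤ Real.cos α) :
    IsTrapezoidIFS i α (fibMap i α) := by
  intro k
  refine ⟨isContractiveSimilarity_fibMap i hc k, ?_, ?_⟩
  · rw [trapezoid_eq_image, trapezoid_eq_image _ (baseStart i α k), Set.image_image, baseEnd_eq]
    congr 1
    funext z
    simp only [fibMap, largeBase]; ring
  · rw [segment_eq_image_mul, segment_eq_image_mul (baseStart i α k), Set.image_image, baseEnd_eq]
    congr 1
    funext z
    simp only [fibMap, largeBase]; ring

/-- The reflection of the plane that preserves the large trapezoid. -/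
def baseReflection (i : ℕ) (α : ℝ) (z : ℂ) : ℂ :=
  largeBase i α * (1 - (starRingEnd ℂ) (z / largeBase i α))

theorem IsTrapezoidIFS.eq_or_eq {i : ℕ} {α : ℝ} (hα : 0 < α) (hα' : α ≤ Real.pi / 2)
    {φ : Fin 5 → ℂ → ℂ} (h : IsTrapezoidIFS i α φ) (k : Fin 5) :
    φ k = fibMap i α k ∨ φ k = fibMap i α k ∘ baseReflection i α := by
  obtain ⟨⟨r, hr0, -, hr⟩, hT, hS⟩ := h k
  have hs := largeBase_ne_zero i α
  have hc : fibCoeff α k ≠ 0 := norm_pos_iff.1 (norm_fibCoeff_pos α k)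
  set s := largeBase i α with hsdef
  set c := fibCoeff α k
  set p := baseStart i α k
  change φ k '' trapezoid α 0 s = _ at hT
  change φ k '' segment ℝ 0 s = _ at hS
  have hinv : ∀ z, (p + c * s * z - p) / (c * s) = z := fun z => by field_simp; ring
  -- The map `φ k` in coordinates in which both the large base and the small base become [0, 1].
  let ψ : ℂ → ℂ := fun z => (φ k (s * z) - p) / (c * s)
  have himage : ∀ X Y : Set ℂ, φ k '' ((fun z => 0 + (s - 0) * z) '' X) =
      (fun z => p + (p + c * s - p) * z) '' Y → ψ '' X = Y := by
    intro X Y hXY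
    have : ψ '' X = (fun w => (w - p) / (c * s)) '' (φ k '' ((fun z => 0 + (s - 0) * z) '' X)) := by
      simp only [Set.image_image, ψ, zero_add, sub_zero]
    rw [this, hXY, Set.image_image]
    simp only [add_sub_cancel_left p (c * s), hinv, Set.image_id']
  rw [trapezoid_eq_image, trapezoid_eq_image _ p, baseEnd_eq] at hT
  rw [segment_eq_image_mul, segment_eq_image_mul p, baseEnd_eq] at hS
  have hψ : ∀ x y, dist (ψ x) (ψ y) = (r / ‖c‖) * dist x y := by
    intro x y
    have := hr (s * x) (s * y)
    rw [Complex.dist_eq, Complex.dist_eq, ← mul_sub, norm_mul] at this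
    rw [Complex.dist_eq, Complex.dist_eq, ← sub_div, norm_div, norm_mul, sub_sub_sub_cancel_right,
      this]
    have h1 := norm_ne_zero_iff.2 hs
    have h2 := norm_ne_zero_iff.2 hc
    field_simp
  have hφ : ∀ z, φ k z = p + c * s * ψ (z / s) := by
    intro z
    simp only [ψ, mul_div_cancel₀ z hs]
    field_simp
    ring
  rcases eq_id_or_reflection hα hα' (div_pos hr0 (norm_fibCoeff_pos α k)) hψ
    (himage _ _ hS) (himage _ _ hT) with h' | h'
  · left
    funext z
    rw [hφ, h', fibMap, mul_assoc, mul_div_cancel₀ _ hs]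
  · right
    funext z
    rw [hφ, h', Function.comp, fibMap, baseReflection, ← hsdef]
    ring

theorem continuous_baseReflection (i : ℕ) (α : ℝ) : Continuous (baseReflection i α) := by
  unfold baseReflection
  fun_prop

theorem pathVertex_last (i : ℕ) (α : ℝ) : pathVertex i α 5 = largeBase i α := by
  have h := congrArg (fun x : ℝ => (x : ℂ)) (ratioR_eq α)
  simp only [Complex.ofReal_add, Complex.ofReal_mul, Complex.ofReal_pow, Complex.ofReal_one,
    Complex.ofReal_cos, Complex.ofReal_ofNat, Complex.cos] at h
  simp only [pathVertex, Matrix.cons_val, largeBase]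
  linear_combination ((Real.sqrt 2 : ℂ) * baseDir i α) * h

/-- The path of small bases is symmetric about the axis of the large trapezoid, so the reflection
interchanges the pieces k and `k.rev`. -/
theorem baseReflection_fibMap (i : ℕ) (α : ℝ) (k : Fin 5) (z : ℂ) :
    baseReflection i α (fibMap i α k z) = fibMap i α k.rev (baseReflection i α z) := by
  have hs := largeBase_ne_zero i α
  have h5 := pathVertex_last i α
  have e1 : (starRingEnd ℂ) (Complex.exp (α * Complex.I)) = Complex.exp (-α * Complex.I) := by
    rw [← Complex.exp_conj]; simp
  have e2 : (starRingEnd ℂ) (Complex.exp (-α * Complex.I)) = Complex.exp (α * Complex.I) := by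
    rw [← Complex.exp_conj]; simp
  obtain ⟨w, rfl⟩ : ∃ w, z = largeBase i α * w := ⟨z / largeBase i α, by field_simp⟩
  have hb : baseReflection i α (largeBase i α * w) = largeBase i α * (1 - (starRingEnd ℂ) w) := by
    rw [baseReflection, mul_div_cancel_left₀ _ hs]
  have hstart : ∀ k, fibMap i α k (largeBase i α * w) = largeBase i α *
      (baseStart i α k / largeBase i α + fibCoeff α k * w) := fun k => by
    rw [fibMap]; field_simp
  rw [hb, hstart, baseReflection, mul_div_cancel_left₀ _ hs, fibMap]
  have h5' : (ratioR α : ℂ) * Complex.exp (α * Complex.I) + ratioR α + ratioR α ^ 2 + ratioR α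
      + ratioR α * Complex.exp (-α * Complex.I) = 1 := by
    refine mul_left_cancel₀ hs ?_
    rw [mul_one]
    simpa only [pathVertex, Matrix.cons_val, largeBase] using h5
  have hdiv : ∀ x, largeBase i α * x / largeBase i α = x := fun x => mul_div_cancel_left₀ _ hs
  fin_cases k <;>
    simp only [Fin.zero_eta, Fin.mk_one, Fin.reduceFinMk, Fin.reduceRev, baseStart, fibCoeff,
      pathVertex, Matrix.cons_val, ← largeBase.eq_1, hdiv, map_add, map_mul, map_neg, map_pow, e1,
      e2, Complex.conj_ofReal] <;>
    linear_combination (-largeBase i α) * h5'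

/-- The mirror image is again an attractor, since the reflection permutes the maps; uniqueness does
the rest. -/
theorem IsAttractor.image_baseReflection {i : ℕ} {α : ℝ} (hc : 0 ≤ Real.cos α) {F : Set ℂ}
    (hF : IsAttractor (fibMap i α) F) : baseReflection i α '' F = F := by
  refine IsAttractor.unique (isContractiveSimilarity_fibMap i hc) hF
    ⟨hF.1.image _, hF.2.1.image (continuous_baseReflection i α), ?_⟩
  conv_lhs => rw [hF.2.2]
  rw [Set.image_iUnion, ← Fin.revPerm.surjective.iUnion_comp]
  refine Set.iUnion_congr fun k => ?_
  rw [Set.image_image, Set.image_image]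
  simp only [baseReflection_fibMap, Fin.revPerm_apply, Fin.rev_rev]

theorem IsTrapezoidIFS.isAttractor {i : ℕ} {α : ℝ} (hα : 0 < α) (hα' : α ≤ Real.pi / 2)
    {φ : Fin 5 → ℂ → ℂ} (h : IsTrapezoidIFS i α φ) {F : Set ℂ}
    (hF : IsAttractor (fibMap i α) F) : IsAttractor φ F := by
  have hc : 0 ≤ Real.cos α := Real.cos_nonneg_of_neg_pi_div_two_le_of_le (by linarith) hα'
  refine ⟨hF.1, hF.2.1, ?_⟩
  conv_lhs => rw [hF.2.2]
  refine Set.iUnion_congr fun k => ?_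
  rcases h.eq_or_eq hα hα' k with h' | h'
  · rw [h']
  · rw [h', Set.image_comp, hF.image_baseReflection hc]

/-! ### Words as isometries, and curves of concatenated words -/

/-- The linear coefficient of the isometry attached to a letter. -/
def letterCoeff (α : ℝ) (l : Fin 2) : ℂ :=
  if l = 0 then -Complex.exp (-(α : ℂ) * Complex.I) else -1

/-- The isometry that carries a curve to its position after one preceding letter. -/
def letterMap (α : ℝ) (l : Fin 2) : ℂ → ℂ :=
  fun z => Complex.I + letterCoeff α l * (starRingEnd ℂ) z

/-- The isometry that carries a curve to its position after the preceding word. -/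
def placement (α : ℝ) : List (Fin 2) → ℂ → ℂ
  | [] => id
  | l :: w => letterMap α l ∘ placement α w

theorem placement_append (α : ℝ) (u w : List (Fin 2)) :
    placement α (u ++ w) = placement α u ∘ placement α w := by
  induction u with
  | nil => rfl
  | cons l u ih => rw [List.cons_append, placement, ih, placement, Function.comp_assoc]

theorem norm_exp_neg_mul_I (α : ℝ) : ‖Complex.exp (-(α : ℂ) * Complex.I)‖ = 1 := by
  simpa using Complex.norm_exp_ofReal_mul_I (-α)

theorem norm_letterCoeff (α : ℝ) (l : Fin 2) : ‖letterCoeff α l‖ = 1 := by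
  unfold letterCoeff
  split_ifs <;> simp [norm_exp_neg_mul_I, - neg_mul]

theorem isometry_letterMap (α : ℝ) (l : Fin 2) : Isometry (letterMap α l) :=
  Isometry.of_dist_eq fun x y => by
    rw [letterMap, letterMap, dist_add_left, Complex.dist_eq, ← mul_sub, norm_mul, norm_letterCoeff,
      one_mul, ← Complex.dist_eq, Complex.dist_conj_conj]

theorem isometry_placement (α : ℝ) (w : List (Fin 2)) : Isometry (placement α w) := by
  induction w with
  | nil => exact isometry_id
  | cons l w ih => exact (isometry_letterMap α l).comp ih

/-- Removing the first letter changes the parity of all positions and so exchanges left and right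
turns. This is why a preceding letter acts by an orientation-reversing isometry. -/
theorem drawDir_cons (α : ℝ) (l : Fin 2) (w : List (Fin 2)) (j : ℕ) :
    drawDir α (l :: w) (j + 1) =
      Real.pi / 2 + (if l = 0 then -α else 0) - (drawDir α w j - Real.pi / 2) := by
  induction j with
  | zero => simp [drawDir]
  | succ j ih =>
    rw [drawDir, ih, drawDir]
    by_cases h : Even (j + 1)
    · have h' : ¬ Even (j + 1 + 1) := by rw [Nat.even_add_one]; simpa using h
      simp only [List.getD_cons_succ, h, h', if_true, if_false]
      split_ifs <;> ring
    · have h' : Even (j + 1 + 1) := by rw [Nat.even_add_one]; simpa using h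
      simp only [List.getD_cons_succ, h, h', if_true, if_false]
      split_ifs <;> ring

theorem exp_drawDir_cons (α : ℝ) (l : Fin 2) (w : List (Fin 2)) (j : ℕ) :
    Complex.exp (drawDir α (l :: w) (j + 1) * Complex.I) =
      letterCoeff α l * (starRingEnd ℂ) (Complex.exp (drawDir α w j * Complex.I)) := by
  have h : Complex.exp (Real.pi / 2 * Complex.I + Real.pi / 2 * Complex.I) = -1 := by
    rw [← Complex.exp_pi_mul_I]; ring_nf
  rw [drawDir_cons, ← Complex.exp_conj, letterCoeff]
  split_ifs with hl
  · rw [neg_eq_neg_one_mul (Complex.exp _), ← h, ← Complex.exp_add, ← Complex.exp_add]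
    congr 1
    simp
    ring
  · rw [← h, ← Complex.exp_add]
    congr 1
    simp
    ring

theorem drawVertex_cons (α : ℝ) (l : Fin 2) (w : List (Fin 2)) (j : ℕ) :
    drawVertex α (l :: w) (j + 1) = letterMap α l (drawVertex α w j) := by
  induction j with
  | zero => simp [drawVertex, drawDir, letterMap, Complex.exp_pi_div_two_mul_I]
  | succ j ih =>
    rw [drawVertex, ih, exp_drawDir_cons, drawVertex, letterMap, letterMap, map_add]
    ring

theorem drawVertex_length (α : ℝ) (w : List (Fin 2)) :
    drawVertex α w w.length = placement α w 0 := by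
  induction w with
  | nil => rfl
  | cons l w ih => rw [List.length_cons, drawVertex_cons, ih]; rfl

theorem letterMap_image_segment (α : ℝ) (l : Fin 2) (x y : ℂ) :
    letterMap α l '' segment ℝ x y = segment ℝ (letterMap α l x) (letterMap α l y) := by
  have h : letterMap α l = conjAffine Complex.I (letterCoeff α l) := by
    funext z; simp [letterMap]
  rw [h, image_segment]

theorem drawCurve_nil (α : ℝ) : drawCurve α [] = ∅ := by simp [drawCurve]

theorem drawCurve_cons (α : ℝ) (l : Fin 2) (w : List (Fin 2)) :
    drawCurve α (l :: w) = segment ℝ 0 Complex.I ∪ letterMap α l '' drawCurve α w := by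
  have h0 : drawVertex α (l :: w) 1 = Complex.I := by
    simp [drawVertex, drawDir, Complex.exp_pi_div_two_mul_I]
  simp only [drawCurve, Set.image_iUnion, letterMap_image_segment, ← drawVertex_cons,
    Finset.mem_range, List.length_cons]
  ext z
  simp only [Set.mem_union, Set.mem_iUnion, exists_prop]
  constructor
  · rintro ⟨j, hj, hz⟩
    cases j with
    | zero =>
      left
      change z ∈ segment ℝ 0 (drawVertex α (l :: w) 1) at hz
      rwa [h0] at hz
    | succ j => exact Or.inr ⟨j, by omega, hz⟩
  · rintro (hz | ⟨j, hj, hz⟩)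
    · refine ⟨0, by omega, ?_⟩
      change z ∈ segment ℝ 0 (drawVertex α (l :: w) 1)
      rwa [h0]
    · exact ⟨j + 1, by omega, hz⟩

theorem drawCurve_append (α : ℝ) (u w : List (Fin 2)) :
    drawCurve α (u ++ w) = drawCurve α u ∪ placement α u '' drawCurve α w := by
  induction u with
  | nil => simp [drawCurve_nil, placement]
  | cons l u ih =>
    rw [List.cons_append, drawCurve_cons, drawCurve_cons, ih, Set.image_union, placement,
      Set.image_comp, Set.union_assoc]

theorem isCompact_drawCurve (α : ℝ) (w : List (Fin 2)) : IsCompact (drawCurve α w) :=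
  (Finset.range w.length).isCompact_biUnion fun j _ => by
    rw [segment_eq_image]
    exact isCompact_Icc.image (by fun_prop)

theorem drawCurve_nonempty (α : ℝ) {w : List (Fin 2)} (hw : w ≠ []) : (drawCurve α w).Nonempty := by
  obtain ⟨l, w, rfl⟩ := List.exists_cons_of_ne_nil hw
  rw [drawCurve_cons]
  exact ⟨0, Or.inl (left_mem_segment ℝ _ _)⟩

theorem drawWidth_eq (α : ℝ) (w : List (Fin 2)) : drawWidth α w = ‖placement α w 0‖ := by
  rw [drawWidth, drawVertex_length, drawVertex, dist_zero_left]

/-! ### Exchanging the two factors of a Fibonacci word -/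

theorem fibWord_add_two (i : ℕ) {n : ℕ} (hn : 1 ≤ n) :
    fibWord i (n + 2) = fibWord i (n + 1) ++ fibWord i n := by
  obtain ⟨n, rfl⟩ := Nat.exists_eq_add_of_le' hn
  rfl

theorem fibWord_ne_nil (i : ℕ) {n : ℕ} (hn : 1 ≤ n) : fibWord i n ≠ [] := by
  induction n using Nat.strong_induction_on with
  | _ n ih =>
    match n with
    | 1 => simp [fibWord]
    | 2 => simp [fibWord]
    | n + 3 =>
      rw [fibWord]
      exact fun h => ih (n + 2) (by omega) (by omega) (List.append_eq_nil_iff.1 h).1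

theorem HausdorffClose.drawCurve_append_left {α : ℝ} {r : ℝ} {x y : List (Fin 2)} (hr : 0 ≤ r)
    (h : HausdorffClose r (drawCurve α x) (drawCurve α y)) (u : List (Fin 2)) :
    HausdorffClose r (drawCurve α (u ++ x)) (drawCurve α (u ++ y)) := by
  rw [drawCurve_append, drawCurve_append]
  refine ((HausdorffClose.refl _).mono hr).union ?_
  simpa using h.image zero_le_one
    (fun a b => by rw [one_mul]; exact ((isometry_placement α u).dist_eq a b).le)

/-- The curve of a Fibonacci word stays within bounded distance of the curve of the word obtained
by exchanging the two factors. -/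
theorem exists_hausdorffClose_swap (i : ℕ) (α : ℝ) :
    ∃ M : ℝ, 0 ≤ M ∧ ∀ n, 1 ≤ n →
      HausdorffClose M (drawCurve α (fibWord i n ++ fibWord i (n + 1)))
        (drawCurve α (fibWord i (n + 1) ++ fibWord i n)) ∧
      dist (placement α (fibWord i n ++ fibWord i (n + 1)) 0)
        (placement α (fibWord i (n + 1) ++ fibWord i n) 0) ≤ M := by
  let x := fibWord i 1 ++ fibWord i 2
  let y := fibWord i 2 ++ fibWord i 1
  have hx : x ≠ [] := by simp [x, fibWord]
  have hy : y ≠ [] := by simp [y, fibWord]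
  refine ⟨max (Metric.hausdorffDist (drawCurve α x) (drawCurve α y))
    (dist (placement α x 0) (placement α y 0)), le_max_of_le_right dist_nonneg, ?_⟩
  intro n hn
  induction n, hn using Nat.le_induction with
  | base =>
    exact ⟨(hausdorffClose_hausdorffDist (isCompact_drawCurve α x) (drawCurve_nonempty α hx)
      (isCompact_drawCurve α y) (drawCurve_nonempty α hy)).mono (le_max_left _ _),
      le_max_right _ _⟩
  | succ n hn ih =>
    -- Both words now begin with f_{n+1}; what remains is the previous pair with its sides
    -- exchanged, so the constant of the case n = 1 never grows.
    rw [fibWord_add_two i hn, List.append_assoc]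
    refine ⟨ih.1.symm.drawCurve_append_left (le_max_of_le_right dist_nonneg) _, ?_⟩
    rw [placement_append, placement_append _ _ (fibWord i n ++ _), Function.comp, Function.comp,
      (isometry_placement α _).dist_eq, dist_comm]
    exact ih.2

/-! ### Perturbed contractions and the linear recurrence -/

theorem tendsto_zero_of_eventually_le_mul_add {V ε : ℕ → ℝ} {q : ℝ} (hq0 : 0 ≤ q) (hq1 : q < 1)
    (hV : ∀ m, 0 ≤ V m) (h : ∀ᶠ m in atTop, V (m + 1) ≤ q * V m + ε m)
    (hε : Tendsto ε atTop (𝓝 0)) : Tendsto V atTop (𝓝 0) := by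
  rw [Metric.tendsto_atTop]
  intro η hη
  -- This tolerance makes η/2 the fixed point of x ↦ q x + (1 - q)(η/2), so the errors never
  -- accumulate beyond η/2.
  have hη' : 0 < (1 - q) * (η / 2) := mul_pos (by linarith) (by linarith)
  obtain ⟨N, hN⟩ := eventually_atTop.1 (h.and (hε.eventually_le_const hη'))
  have hstep : ∀ j, V (N + j) ≤ q ^ j * V N + η / 2 := by
    intro j
    induction j with
    | zero => simp; linarith
    | succ j ih =>
      have h1 := hN (N + j) (by omega)
      calc V (N + (j + 1)) ≤ q * V (N + j) + ε (N + j) := h1.1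
        _ ≤ q * (q ^ j * V N + η / 2) + (1 - q) * (η / 2) :=
            add_le_add (mul_le_mul_of_nonneg_left ih hq0) h1.2
        _ = q ^ (j + 1) * V N + η / 2 := by ring
  have hlim : Tendsto (fun j : ℕ => q ^ j * V N) atTop (𝓝 (0 * V N)) :=
    (tendsto_pow_atTop_nhds_zero_of_lt_one hq0 hq1).mul_const _
  rw [zero_mul] at hlim
  obtain ⟨J, hJ⟩ := eventually_atTop.1 (hlim.eventually_lt_const (half_pos hη))
  refine ⟨N + J, fun n hn => ?_⟩
  obtain ⟨j, rfl⟩ := Nat.exists_eq_add_of_le (show N ≤ n by omega)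
  have h1 := hJ j (by omega)
  have h2 := hstep j
  rw [Real.dist_eq, sub_zero, abs_of_nonneg (hV _)]
  linarith

theorem tendsto_zero_of_two_step {e r r' ε : ℕ → ℝ} {R : ℝ} (hR : R < 1 / 2) (hR0 : 0 < R)
    (he : ∀ m, 0 ≤ e m) (hr : Tendsto r atTop (𝓝 R)) (hr' : Tendsto r' atTop (𝓝 (R ^ 2)))
    (hε : Tendsto ε atTop (𝓝 0)) (h : ∀ m, e (m + 2) ≤ r m * e (m + 1) + r' m * e m + ε m) :
    Tendsto e atTop (𝓝 0) := by
  -- The weight 7/20 turns two steps into one: with coefficients at most 1/2 and 1/4, the factor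
  -- 17/20 works because 1/2 + 7/20 = 17/20 and 1/4 ≤ (17/20)(7/20).
  have hV : Tendsto (fun m => e (m + 1) + 7 / 20 * e m) atTop (𝓝 0) := by
    refine tendsto_zero_of_eventually_le_mul_add (q := 17 / 20) (by norm_num) (by norm_num)
      (fun m => add_nonneg (he _) (mul_nonneg (by norm_num) (he m))) ?_ hε
    filter_upwards [hr.eventually_le_const hR,
      hr'.eventually_le_const (show R ^ 2 < 1 / 4 by nlinarith)] with m h1 h2
    nlinarith [h m, mul_le_mul_of_nonneg_right h1 (he (m + 1)),
      mul_le_mul_of_nonneg_right h2 (he m), he m, he (m + 1)]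
  refine squeeze_zero he (fun m => ?_) (by simpa using hV.const_mul (20 / 7))
  nlinarith [he m, he (m + 1)]

section Recurrence

variable {t R : ℝ} {Y : ℕ → ℝ}

theorem lt_half_of_quadratic (ht : 1 ≤ t) (hR0 : 0 < R) (hR : R ^ 2 + 2 * t * R = 1) :
    R < 1 / 2 := by
  nlinarith [mul_le_mul_of_nonneg_right ht hR0.le]

/-- The ratios obey x ↦ 1/(2t + x), whose fixed point is R. A step multiplies the deviation from R
by -R times the new ratio, of absolute value below 1/2. -/
theorem tendsto_ratio_of_recurrence (ht : 1 ≤ t) (hR0 : 0 < R) (hR : R ^ 2 + 2 * t * R = 1)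
    (hY : ∀ m, 0 < Y m) (hrec : ∀ m, Y (m + 2) = 2 * t * Y (m + 1) + Y m) :
    Tendsto (fun m => Y m / Y (m + 1)) atTop (𝓝 R) := by
  rw [tendsto_iff_dist_tendsto_zero]
  refine tendsto_zero_of_eventually_le_mul_add (q := 1 / 2) (ε := 0) (by norm_num) (by norm_num)
    (fun m => dist_nonneg) (Eventually.of_forall fun m => ?_) tendsto_const_nhds
  have h1 := hY m
  have h2 := hY (m + 1)
  have h3 := hY (m + 2)
  have hlt := lt_half_of_quadratic ht hR0 hR
  have hx : Y (m + 1) / Y (m + 2) ≤ 1 := by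
    rw [div_le_one h3, hrec]; nlinarith
  have e : Y (m + 1) / Y (m + 2) - R = -(R * (Y (m + 1) / Y (m + 2))) * (Y m / Y (m + 1) - R) := by
    field_simp
    rw [hrec]
    linear_combination (-Y (m + 1)) * hR
  rw [Real.dist_eq, Real.dist_eq, e, abs_mul, abs_neg, abs_of_pos (mul_pos hR0 (div_pos h2 h3)),
    Pi.zero_apply, add_zero]
  refine mul_le_mul_of_nonneg_right ?_ (abs_nonneg _)
  nlinarith

theorem tendsto_ratio_two_of_recurrence (ht : 1 ≤ t) (hR0 : 0 < R) (hR : R ^ 2 + 2 * t * R = 1)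
    (hY : ∀ m, 0 < Y m) (hrec : ∀ m, Y (m + 2) = 2 * t * Y (m + 1) + Y m) :
    Tendsto (fun m => Y m / Y (m + 2)) atTop (𝓝 (R ^ 2)) := by
  have h := tendsto_ratio_of_recurrence ht hR0 hR hY hrec
  rw [sq]
  refine (h.mul (h.comp (tendsto_add_atTop_nat 1))).congr fun m => ?_
  have h2 := (hY (m + 1)).ne'
  have h3 := (hY (m + 2)).ne'
  simp only [Function.comp]
  field_simp

theorem tendsto_inv_of_recurrence (ht : 1 ≤ t) (hR0 : 0 < R) (hR : R ^ 2 + 2 * t * R = 1)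
    (hY : ∀ m, 0 < Y m) (hrec : ∀ m, Y (m + 2) = 2 * t * Y (m + 1) + Y m) :
    Tendsto (fun m => (Y m)⁻¹) atTop (𝓝 0) := by
  refine tendsto_zero_of_eventually_le_mul_add (q := 1 / 2) (ε := 0) (by norm_num) (by norm_num)
    (fun m => (inv_pos.2 (hY m)).le) ?_ tendsto_const_nhds
  filter_upwards [(tendsto_ratio_of_recurrence ht hR0 hR hY hrec).eventually_le_const
    (lt_half_of_quadratic ht hR0 hR)] with m hm
  have h1 := hY m
  have e : (Y (m + 1))⁻¹ = Y m / Y (m + 1) * (Y m)⁻¹ := by field_simp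
  rw [e, Pi.zero_apply, add_zero]
  exact mul_le_mul_of_nonneg_right hm (inv_pos.2 h1).le

end Recurrence

/-! ### Convergence of sets satisfying an approximate recursion -/

/-- Three errors add up: the displacement of the starting point, the old distance d after rescaling,
and the deviation of the scale ratio from l, multiplied by the bound B on the limit set. -/
theorem HausdorffClose.scaled_piece {K F : Set ℂ} {d B Q q l : ℝ} (hq : 0 < q) (hQ : 0 < Q)
    (U : ℂ →ₗᵢ[ℝ] ℂ) (c' c : ℂ) (hB : ∀ y ∈ F, ‖y‖ ≤ B)
    (h : HausdorffClose d ((fun z => (q : ℂ) * z) '' K) F) :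
    HausdorffClose (‖(Q : ℂ) * c' - c‖ + Q / q * d + |Q / q - l| * B)
      ((fun z => (Q : ℂ) * z) '' ((fun z => c' + U z) '' K)) ((fun z => c + (l : ℂ) * U z) '' F) := by
  have e : (fun z => (Q : ℂ) * z) '' ((fun z => c' + U z) '' K) =
      (fun w => (Q : ℂ) * c' + ((Q / q : ℝ) : ℂ) * U w) '' ((fun z => (q : ℂ) * z) '' K) := by
    simp only [Set.image_image]
    congr 1
    funext z
    have hU : U ((q : ℂ) * z) = (q : ℂ) * U z := by
      rw [← Complex.real_smul, U.map_smul, Complex.real_smul]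
    have hq' : (q : ℂ) ≠ 0 := by exact_mod_cast hq.ne'
    rw [hU, Complex.ofReal_div]
    field_simp
  rw [e]
  refine h.image₂ fun x _ y hy hxy => ?_
  have e2 : (Q : ℂ) * c' + ((Q / q : ℝ) : ℂ) * U x - (c + (l : ℂ) * U y) =
      ((Q : ℂ) * c' - c) + ((Q / q : ℝ) : ℂ) * U (x - y) + ((Q / q - l : ℝ) : ℂ) * U y := by
    rw [map_sub]; push_cast; ring
  rw [Complex.dist_eq, e2]
  refine (norm_add₃_le).trans ?_
  rw [norm_mul, norm_mul, U.norm_map, U.norm_map, Complex.norm_real, Complex.norm_real,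
    Real.norm_eq_abs, Real.norm_eq_abs, abs_of_pos (div_pos hQ hq)]
  rw [Complex.dist_eq] at hxy
  gcongr
  exact hB y hy

/-- Convergence of rescaled sets which satisfy, up to bounded errors, a recursion modelled on an
iterated function system. -/
theorem exists_hausdorffClose_tendsto_zero {t R : ℝ} {Y : ℕ → ℝ} (ht : 1 ≤ t) (hR0 : 0 < R)
    (hR : R ^ 2 + 2 * t * R = 1) (hY : ∀ m, 0 < Y m)
    (hrec : ∀ m, Y (m + 2) = 2 * t * Y (m + 1) + Y m) {κ : ℝ} (hκ : 0 < κ)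
    {K : ℕ → Set ℂ} (hK0 : ∀ m, (K m).Nonempty) (hKc : ∀ m, IsCompact (K m))
    {S : Fin 5 → ℕ → Set ℂ} {lag : Fin 5 → Fin 2} {M : ℝ} (hM : 0 ≤ M)
    (hS : ∀ k m, HausdorffClose M (S k m) (K (m + lag k)))
    (U : Fin 5 → ℂ →ₗᵢ[ℝ] ℂ) {c' : Fin 5 → ℕ → ℂ} {c : Fin 5 → ℂ}
    (hK : ∀ m, K (m + 2) = ⋃ k, (fun z => c' k m + U k z) '' S k m)
    (hc : ∀ k, Tendsto (fun m => ((κ / Y (m + 2) : ℝ) : ℂ) * c' k m) atTop (𝓝 (c k)))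
    {F : Set ℂ} (hF0 : F.Nonempty) (hFc : IsCompact F)
    (hF : F = ⋃ k, (fun z => c k + ((R ^ (2 - (lag k : ℕ)) : ℝ) : ℂ) * U k z) '' F) :
    ∃ e : ℕ → ℝ, Tendsto e atTop (𝓝 0) ∧
      ∀ m, HausdorffClose (e m) ((fun z => ((κ / Y m : ℝ) : ℂ) * z) '' K m) F := by
  obtain ⟨B, hB0, hB⟩ := hFc.isBounded.exists_pos_norm_le
  have hq : ∀ m, 0 < κ / Y m := fun m => div_pos hκ (hY m)
  let D : ℕ → Set ℂ := fun m => (fun z => ((κ / Y m : ℝ) : ℂ) * z) '' K m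
  have hDc : ∀ m, IsCompact (D m) := fun m => (hKc m).image (by fun_prop)
  have hD : ∀ m, HausdorffClose (Metric.hausdorffDist (D m) F) (D m) F := fun m =>
    hausdorffClose_hausdorffDist (hDc m) ((hK0 m).image _) hFc hF0
  have hratio : ∀ a b, κ / Y a / (κ / Y b) = Y b / Y a := fun a b => by
    have := (hY a).ne'
    have := (hY b).ne'
    field_simp
  -- The part of the error of piece k that depends neither on earlier distances nor on M.
  let δ : Fin 5 → ℕ → ℝ := fun k m => ‖((κ / Y (m + 2) : ℝ) : ℂ) * c' k m - c k‖ +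
    |Y (m + lag k) / Y (m + 2) - R ^ (2 - (lag k : ℕ))| * B
  have hδ0 : ∀ k m, 0 ≤ δ k m := fun k m => by positivity
  let ε : ℕ → ℝ := fun m => ∑ k, δ k m + 2 * (κ * M * (Y (m + 2))⁻¹)
  have hr1 := tendsto_ratio_of_recurrence ht hR0 hR hY hrec
  have hr2 := tendsto_ratio_two_of_recurrence ht hR0 hR hY hrec
  have hinv := tendsto_inv_of_recurrence ht hR0 hR hY hrec
  have hlag : ∀ k, Tendsto (fun m => Y (m + lag k) / Y (m + 2)) atTop
      (𝓝 (R ^ (2 - (lag k : ℕ)))) := by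
    intro k
    generalize lag k = j
    fin_cases j
    · simpa using hr2
    · simpa [Function.comp_def] using hr1.comp (tendsto_add_atTop_nat 1)
  have hε : Tendsto ε atTop (𝓝 0) := by
    have h1 : Tendsto (fun m => ∑ k, δ k m) atTop (𝓝 (∑ k : Fin 5, (0 + 0 * B))) := by
      refine tendsto_finsetSum _ fun k _ => ?_
      refine Tendsto.add ?_ (Tendsto.mul_const _ ?_)
      · simpa using ((hc k).sub_const (c k)).norm
      · simpa using ((hlag k).sub_const (R ^ (2 - (lag k : ℕ)))).abs
    have h2 := ((hinv.comp (tendsto_add_atTop_nat 2)).const_mul (κ * M)).const_mul 2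
    simpa using h1.add h2
  let e : ℕ → ℝ := fun m => Metric.hausdorffDist (D m) F
  have he0 : ∀ m, 0 ≤ e m := fun m => Metric.hausdorffDist_nonneg
  refine ⟨e, tendsto_zero_of_two_step (lt_half_of_quadratic ht hR0 hR) hR0 he0
    (hr1.comp (tendsto_add_atTop_nat 1)) hr2 hε fun m => ?_, hD⟩
  have hrpos : 0 ≤ Y (m + 1) / Y (m + 2) := (div_pos (hY _) (hY _)).le
  have hrpos' : 0 ≤ Y m / Y (m + 2) := (div_pos (hY _) (hY _)).le
  have hbound0 : 0 ≤ Y (m + 1) / Y (m + 2) * e (m + 1) + Y m / Y (m + 2) * e m + ε m := by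
    have := he0 m
    have := he0 (m + 1)
    have : 0 ≤ ε m := add_nonneg (Finset.sum_nonneg fun k _ => hδ0 k m)
      (mul_nonneg two_pos.le (mul_nonneg (mul_nonneg hκ.le hM) (inv_pos.2 (hY _)).le))
    positivity
  suffices hclose : HausdorffClose
      (Y (m + 1) / Y (m + 2) * e (m + 1) + Y m / Y (m + 2) * e m + ε m) (D (m + 2)) F from
    ENNReal.toReal_le_of_le_ofReal hbound0 hclose.hausdorffEDist_le
  have hDm : D (m + 2) = ⋃ k, (fun z => ((κ / Y (m + 2) : ℝ) : ℂ) * z) ''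
      ((fun z => c' k m + U k z) '' S k m) := by
    simp only [D]
    rw [hK m, Set.image_iUnion]
  rw [hDm, hF]
  refine HausdorffClose.iUnion fun k => ?_
  have hSD : HausdorffClose (κ / Y (m + lag k) * M)
      ((fun z => ((κ / Y (m + lag k) : ℝ) : ℂ) * z) '' S k m) (D (m + lag k)) := by
    refine (hS k m).image (hq _).le fun x y => ?_
    rw [Complex.dist_eq, ← mul_sub, norm_mul, Complex.norm_real, Real.norm_eq_abs,
      abs_of_pos (hq _), Complex.dist_eq]
  refine ((hSD.trans (hD _)).scaled_piece (hq _) (hq (m + 2)) (U k) (c' k m) (c k) hB).mono ?_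
  rw [hratio]
  have h1 : δ k m ≤ ∑ k, δ k m :=
    Finset.single_le_sum (f := fun k => δ k m) (fun k _ => hδ0 k m) (Finset.mem_univ k)
  have h2 : Y (m + lag k) / Y (m + 2) * e (m + lag k) ≤
      Y (m + 1) / Y (m + 2) * e (m + 1) + Y m / Y (m + 2) * e m := by
    have := mul_nonneg hrpos (he0 (m + 1))
    have := mul_nonneg hrpos' (he0 m)
    generalize lag k = j
    fin_cases j <;> simp <;> linarith
  have h3 : Y (m + lag k) / Y (m + 2) * (κ / Y (m + lag k) * M) = κ * M * (Y (m + 2))⁻¹ := by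
    have := (hY (m + lag k)).ne'
    have := (hY (m + 2)).ne'
    field_simp
  have h4 : 0 ≤ κ * M * (Y (m + 2))⁻¹ := mul_nonneg (mul_nonneg hκ.le hM) (inv_pos.2 (hY _)).le
  change _ + Y (m + lag k) / Y (m + 2) * (κ / Y (m + lag k) * M + e (m + lag k)) + _ ≤ _
  rw [mul_add, h3]
  simp only [δ] at h1
  simp only [ε, δ]
  linarith

/-! ### Linear parts and endpoints along the base indices -/

/-- The direction factor of a single right turn. -/
def turn (α : ℝ) : ℂ := Complex.exp (-(α : ℂ) * Complex.I)

theorem conj_turn (α : ℝ) : (starRingEnd ℂ) (turn α) = Complex.exp (α * Complex.I) := by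
  rw [turn, ← Complex.exp_conj]; simp

theorem turn_mul_conj (α : ℝ) : turn α * (starRingEnd ℂ) (turn α) = 1 := by
  rw [conj_turn, turn, ← Complex.exp_add]; simp

theorem turn_add_conj (α : ℝ) : turn α + (starRingEnd ℂ) (turn α) = 2 * Real.cos α := by
  rw [conj_turn, turn, Complex.ofReal_cos, Complex.cos]; ring

/-- The linear coefficient of the glide reflections attached to the words
`fibWord i (baseIndex i m)`. -/
def glideCoeff (i : ℕ) (α : ℝ) : ℂ := if Even i then -turn α else -1

theorem glideCoeff_mul_conj (i : ℕ) (α : ℝ) :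
    glideCoeff i α * (starRingEnd ℂ) (glideCoeff i α) = 1 := by
  unfold glideCoeff
  split_ifs
  · simpa using turn_mul_conj α
  · simp

theorem baseDir_eq (i : ℕ) (α : ℝ) :
    baseDir i α = Complex.I * if Even i then turn α else turn (α / 2) := by
  conv_rhs => rw [← Complex.exp_pi_div_two_mul_I]
  unfold baseDir
  split_ifs <;> rw [turn, ← Complex.exp_add] <;> congr 1 <;> push_cast <;> ring

theorem turn_half_sq (α : ℝ) : turn (α / 2) ^ 2 = turn α := by
  rw [turn, turn, ← Complex.exp_nat_mul]; congr 1; push_cast; ring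

theorem baseDir_sq (i : ℕ) (α : ℝ) : baseDir i α ^ 2 = turn α * glideCoeff i α := by
  rw [baseDir_eq, mul_pow, Complex.I_sq, glideCoeff]
  split_ifs
  · ring
  · rw [turn_half_sq]; ring

theorem baseDir_mul_conj (i : ℕ) (α : ℝ) : baseDir i α * (starRingEnd ℂ) (baseDir i α) = 1 := by
  rw [Complex.mul_conj, Complex.normSq_eq_norm_sq, norm_baseDir]; simp

/-- The indices `1, 4, 7, …` for even `i` and `2, 5, 8, …` for odd `i`. -/
def baseIndex (i m : ℕ) : ℕ := 3 * m + if Even i then 1 else 2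

theorem one_le_baseIndex (i m : ℕ) : 1 ≤ baseIndex i m := by
  unfold baseIndex; split_ifs <;> omega

theorem baseIndex_succ (i m : ℕ) : baseIndex i (m + 1) = baseIndex i m + 3 := by
  unfold baseIndex; ring

/-- The factor `turn α` or its inverse, alternating with `m`. -/
def altTurn (i : ℕ) (α : ℝ) (m : ℕ) : ℂ :=
  if Even (i + m) then (starRingEnd ℂ) (turn α) else turn α

theorem altTurn_succ (i : ℕ) (α : ℝ) (m : ℕ) :
    altTurn i α (m + 1) = (starRingEnd ℂ) (altTurn i α m) := by
  have h : Even (i + (m + 1)) ↔ ¬ Even (i + m) := Nat.even_add_one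
  unfold altTurn
  by_cases h' : Even (i + m) <;> simp [h, h']

theorem altTurn_mul_conj (i : ℕ) (α : ℝ) (m : ℕ) :
    altTurn i α m * (starRingEnd ℂ) (altTurn i α m) = 1 := by
  unfold altTurn
  split_ifs
  · rw [Complex.conj_conj, mul_comm, turn_mul_conj]
  · exact turn_mul_conj α

theorem altTurn_add_conj (i : ℕ) (α : ℝ) (m : ℕ) :
    altTurn i α m + (starRingEnd ℂ) (altTurn i α m) = 2 * Real.cos α := by
  unfold altTurn
  split_ifs
  · rw [Complex.conj_conj, add_comm, turn_add_conj]
  · exact turn_add_conj α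

/-- The last vertex of the curve of `fibWord i n`. -/
def fibEnd (i : ℕ) (α : ℝ) (n : ℕ) : ℂ := placement α (fibWord i n) 0

theorem placement_fibWord_add_two (i : ℕ) (α : ℝ) {n : ℕ} (hn : 1 ≤ n) (z : ℂ) :
    placement α (fibWord i (n + 2)) z =
      placement α (fibWord i (n + 1)) (placement α (fibWord i n) z) := by
  rw [fibWord_add_two i hn, placement_append, Function.comp]

/-- A right turn is undone by the following left turn, so each pair of zeros acts as a translation.
-/
theorem placement_replicate_zero (α : ℝ) (j : ℕ) (z : ℂ) :
    placement α (List.replicate (2 * j) 0) z = j * (Complex.I * (1 + turn α)) + z := by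
  induction j with
  | zero => simp [placement]
  | succ j ih =>
    have h : 2 * (j + 1) = 2 * j + 1 + 1 := by ring
    have ha := turn_mul_conj α
    rw [h, List.replicate_succ, List.replicate_succ, placement, placement, Function.comp,
      Function.comp, ih, letterMap, letterMap, letterCoeff, if_pos rfl, ← turn]
    simp only [map_add, map_mul, map_neg, map_natCast, Complex.conj_I, Complex.conj_conj, map_one]
    push_cast
    linear_combination ((j : ℂ) * (Complex.I * (1 + turn α)) + z) * ha +
      (turn α * Complex.I - Complex.I * turn α) * ha

theorem placement_fibWord_one (i : ℕ) (α : ℝ) (z : ℂ) :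
    placement α (fibWord i 1) z = Complex.I - turn α * (starRingEnd ℂ) z := by
  simp [fibWord, placement, letterMap, letterCoeff, turn, sub_eq_add_neg]

theorem placement_one (α : ℝ) (z : ℂ) :
    placement α [1] z = Complex.I - (starRingEnd ℂ) z := by
  simp [placement, letterMap, letterCoeff, sub_eq_add_neg]

theorem placement_fibWord_two_of_even (α : ℝ) (j : ℕ) (z : ℂ) :
    placement α (fibWord (2 * j + 2) 2) z =
      (j + 1) * (Complex.I * (1 + turn α)) + turn α * z := by
  -- The middle letter 0 is written as `fibWord 1 1` to make `placement_fibWord_one` applicable; the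
  -- superscript 1 is arbitrary.
  have h : fibWord (2 * j + 2) 2 = List.replicate (2 * j) 0 ++ (fibWord 1 1 ++ [1]) := by
    simp only [fibWord]
    rw [show 2 * j + 2 - 1 = 2 * j + 1 by omega, List.replicate_succ']
    simp
  rw [h, placement_append, placement_append, Function.comp, Function.comp,
    placement_replicate_zero, placement_fibWord_one, placement_one]
  simp only [map_sub, Complex.conj_I, Complex.conj_conj]
  ring

theorem placement_fibWord_two_of_odd (α : ℝ) (j : ℕ) (z : ℂ) :
    placement α (fibWord (2 * j + 1) 2) z =
      j * (Complex.I * (1 + turn α)) + Complex.I - (starRingEnd ℂ) z := by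
  rw [fibWord, Nat.add_sub_cancel, placement_append, Function.comp, placement_replicate_zero,
    placement_one]
  ring

theorem placement_baseIndex_zero (i : ℕ) (hi : 2 ≤ i) (α : ℝ) :
    (∀ z, placement α (fibWord i (baseIndex i 0)) z =
      fibEnd i α (baseIndex i 0) + glideCoeff i α * (starRingEnd ℂ) z) ∧
    (∀ z, placement α (fibWord i (baseIndex i 0 + 1)) z =
      fibEnd i α (baseIndex i 0 + 1) + (starRingEnd ℂ) (altTurn i α 0) * z) := by
  rcases Nat.even_or_odd i with h | h
  · obtain ⟨j, rfl⟩ : ∃ j, i = 2 * j + 2 := by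
      obtain ⟨j, hj⟩ := h
      exact ⟨j - 1, by omega⟩
    simp only [baseIndex, if_pos h, fibEnd, glideCoeff, altTurn, add_zero, mul_zero, zero_add,
      Nat.reduceAdd, Complex.conj_conj, placement_fibWord_one, placement_fibWord_two_of_even]
    constructor <;> (intro z; simp only [map_zero]; try ring)
  · obtain ⟨j, rfl⟩ := h
    have h : ¬ Even (2 * j + 1) := by simp
    have h3 := placement_fibWord_add_two (2 * j + 1) α (n := 1) le_rfl
    simp only [Nat.reduceAdd] at h3
    simp only [baseIndex, if_neg h, fibEnd, glideCoeff, altTurn, add_zero, mul_zero, zero_add,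
      Nat.reduceAdd, h3, placement_fibWord_one, placement_fibWord_two_of_odd]
    constructor <;> intro z <;> simp only [map_zero, map_sub, map_mul, Complex.conj_I,
      Complex.conj_conj] <;> ring

/-- One step `m ↦ m + 1` of the recursion for the isometries attached to Fibonacci words. -/
theorem placement_step {i : ℕ} {α : ℝ} {m : ℕ}
    (hA : ∀ z, placement α (fibWord i (baseIndex i m)) z =
      fibEnd i α (baseIndex i m) + glideCoeff i α * (starRingEnd ℂ) z)
    (hE : ∀ z, placement α (fibWord i (baseIndex i m + 1)) z =
      fibEnd i α (baseIndex i m + 1) + (starRingEnd ℂ) (altTurn i α m) * z) :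
    (∀ z, placement α (fibWord i (baseIndex i m + 2)) z =
      fibEnd i α (baseIndex i m + 1) + (starRingEnd ℂ) (altTurn i α m) *
        (fibEnd i α (baseIndex i m) + glideCoeff i α * (starRingEnd ℂ) z)) ∧
    (∀ z, placement α (fibWord i (baseIndex i (m + 1))) z =
      fibEnd i α (baseIndex i m + 1) + (starRingEnd ℂ) (altTurn i α m) *
        (fibEnd i α (baseIndex i m) +
          glideCoeff i α * (starRingEnd ℂ) (fibEnd i α (baseIndex i m + 1))) +
        glideCoeff i α * (starRingEnd ℂ) z) ∧
    (∀ z, placement α (fibWord i (baseIndex i (m + 1) + 1)) z =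
      fibEnd i α (baseIndex i m + 1) + (starRingEnd ℂ) (altTurn i α m) *
        (fibEnd i α (baseIndex i m) +
          glideCoeff i α * (starRingEnd ℂ) (fibEnd i α (baseIndex i m + 1))) +
        glideCoeff i α * ((starRingEnd ℂ) (fibEnd i α (baseIndex i m + 1)) + altTurn i α m *
          (starRingEnd ℂ) (fibEnd i α (baseIndex i m))) +
        altTurn i α m * z) := by
  have hn := one_le_baseIndex i m
  have ha := altTurn_mul_conj i α m
  have hd := glideCoeff_mul_conj i α
  have h2 : ∀ z, placement α (fibWord i (baseIndex i m + 2)) z =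
      fibEnd i α (baseIndex i m + 1) + (starRingEnd ℂ) (altTurn i α m) *
        (fibEnd i α (baseIndex i m) + glideCoeff i α * (starRingEnd ℂ) z) := fun z => by
    rw [placement_fibWord_add_two i α hn, hE, hA]
  have h3 : ∀ z, placement α (fibWord i (baseIndex i (m + 1))) z =
      fibEnd i α (baseIndex i m + 1) + (starRingEnd ℂ) (altTurn i α m) *
        (fibEnd i α (baseIndex i m) +
          glideCoeff i α * (starRingEnd ℂ) (fibEnd i α (baseIndex i m + 1))) +
        glideCoeff i α * (starRingEnd ℂ) z := fun z => by
    rw [baseIndex_succ, placement_fibWord_add_two i α (show 1 ≤ baseIndex i m + 1 by omega), h2, hE]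
    simp only [map_add, map_mul, Complex.conj_conj]
    linear_combination (glideCoeff i α * (starRingEnd ℂ) z) * ha
  refine ⟨h2, h3, fun z => ?_⟩
  have e : baseIndex i (m + 1) + 1 = baseIndex i m + 2 + 2 := by rw [baseIndex_succ]
  rw [e, placement_fibWord_add_two i α (show 1 ≤ baseIndex i m + 2 by omega), ← baseIndex_succ, h3,
    h2]
  simp only [map_add, map_mul, Complex.conj_conj]
  linear_combination (altTurn i α m * z) * hd

/-- `placement_step` preserves `glideCoeff` and conjugates `altTurn`, so the linear parts are known
for all m and only the endpoints have to be followed. -/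
theorem placement_baseIndex {i : ℕ} (hi : 2 ≤ i) (α : ℝ) (m : ℕ) :
    (∀ z, placement α (fibWord i (baseIndex i m)) z =
      fibEnd i α (baseIndex i m) + glideCoeff i α * (starRingEnd ℂ) z) ∧
    (∀ z, placement α (fibWord i (baseIndex i m + 1)) z =
      fibEnd i α (baseIndex i m + 1) + (starRingEnd ℂ) (altTurn i α m) * z) := by
  induction m with
  | zero => exact placement_baseIndex_zero i hi α
  | succ m ih =>
    obtain ⟨-, h3, h4⟩ := placement_step ih.1 ih.2
    rw [altTurn_succ, Complex.conj_conj]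
    constructor
    · intro z
      rw [fibEnd, h3, h3, map_zero, mul_zero, add_zero]
    · intro z
      rw [fibEnd, h4, h4, mul_zero, add_zero]

theorem fibEnd_baseIndex_succ {i : ℕ} (hi : 2 ≤ i) (α : ℝ) (m : ℕ) :
    fibEnd i α (baseIndex i (m + 1)) =
      fibEnd i α (baseIndex i m + 1) + (starRingEnd ℂ) (altTurn i α m) *
        (fibEnd i α (baseIndex i m) +
          glideCoeff i α * (starRingEnd ℂ) (fibEnd i α (baseIndex i m + 1))) := by
  have h := placement_baseIndex hi α m
  rw [fibEnd, (placement_step h.1 h.2).2.1]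
  simp

theorem fibEnd_baseIndex_succ_add_one {i : ℕ} (hi : 2 ≤ i) (α : ℝ) (m : ℕ) :
    fibEnd i α (baseIndex i (m + 1) + 1) = fibEnd i α (baseIndex i (m + 1)) +
      glideCoeff i α * ((starRingEnd ℂ) (fibEnd i α (baseIndex i m + 1)) + altTurn i α m *
          (starRingEnd ℂ) (fibEnd i α (baseIndex i m))) := by
  have h := placement_baseIndex hi α m
  rw [fibEnd_baseIndex_succ hi, fibEnd, (placement_step h.1 h.2).2.2]
  simp

/-- The endpoint p of the other word enters only through p + ā d p̄, with a = `altTurn` and d =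
`glideCoeff`; `fibEnd_baseIndex_succ` expresses this combination by endpoints at base indices. -/
theorem fibEnd_recurrence {i : ℕ} (hi : 2 ≤ i) (α : ℝ) (m : ℕ) :
    fibEnd i α (baseIndex i (m + 2)) =
      (1 + altTurn i α m) ^ 2 * fibEnd i α (baseIndex i (m + 1)) +
      (1 + altTurn i α m) * altTurn i α m * glideCoeff i α *
        (starRingEnd ℂ) (fibEnd i α (baseIndex i m)) -
      altTurn i α m * fibEnd i α (baseIndex i m) := by
  have ha := altTurn_mul_conj i α m
  have hd := glideCoeff_mul_conj i α
  have h1 := fibEnd_baseIndex_succ hi α m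
  have h2 := fibEnd_baseIndex_succ_add_one hi α m
  rw [fibEnd_baseIndex_succ hi α (m + 1), altTurn_succ, Complex.conj_conj, h2, h1]
  simp only [map_add, map_mul, Complex.conj_conj]
  generalize (starRingEnd ℂ) (altTurn i α m) = a' at *
  generalize altTurn i α m = a at *
  generalize (starRingEnd ℂ) (glideCoeff i α) = d' at *
  generalize glideCoeff i α = d at *
  generalize (starRingEnd ℂ) (fibEnd i α (baseIndex i m)) = v'
  generalize fibEnd i α (baseIndex i m) = v
  generalize (starRingEnd ℂ) (fibEnd i α (baseIndex i m + 1)) = p'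
  generalize fibEnd i α (baseIndex i m + 1) = p
  obtain rfl : a' = a⁻¹ := eq_inv_of_mul_eq_one_right ha
  obtain rfl : d' = d⁻¹ := eq_inv_of_mul_eq_one_right hd
  have ha0 : a ≠ 0 := left_ne_zero_of_mul_eq_one ha
  have hd0 : d ≠ 0 := left_ne_zero_of_mul_eq_one hd
  field_simp
  ring

/-! ### Solving the endpoint recurrence -/

/-- The solution of `y (m + 2) = 2 t y (m + 1) + y m` with given initial values. -/
def linRec (t y₀ y₁ : ℝ) : ℕ → ℝ
  | 0 => y₀
  | 1 => y₁
  | m + 2 => 2 * t * linRec t y₀ y₁ (m + 1) + linRec t y₀ y₁ m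

theorem linRec_pos {t y₀ y₁ : ℝ} (ht : 0 ≤ t) (h0 : 0 < y₀) (h1 : 0 < y₁) (m : ℕ) :
    0 < linRec t y₀ y₁ m := by
  induction m using Nat.twoStepInduction with
  | zero => exact h0
  | one => exact h1
  | more m ih0 ih1 => rw [linRec]; positivity

/-- The direction of the chord of the `m`-th curve, up to bounded errors. -/
def altDir (i : ℕ) (α : ℝ) (m : ℕ) : ℂ :=
  if Even (i + m) then glideCoeff i α * (starRingEnd ℂ) (baseDir i α) else baseDir i α

theorem altDir_mul_conj (i : ℕ) (α : ℝ) (m : ℕ) :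
    altDir i α m * (starRingEnd ℂ) (altDir i α m) = 1 := by
  have h1 := baseDir_mul_conj i α
  have h2 := glideCoeff_mul_conj i α
  unfold altDir
  split_ifs
  · rw [map_mul, Complex.conj_conj]
    linear_combination (baseDir i α * (starRingEnd ℂ) (baseDir i α)) * h2 + h1
  · exact h1

theorem altDir_succ (i : ℕ) (α : ℝ) (m : ℕ) :
    altDir i α (m + 1) = glideCoeff i α * (starRingEnd ℂ) (altDir i α m) := by
  have h2 := glideCoeff_mul_conj i α
  have h : Even (i + (m + 1)) ↔ ¬ Even (i + m) := Nat.even_add_one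
  unfold altDir
  by_cases h' : Even (i + m)
  · rw [if_neg (by simpa [h] using h'), if_pos h', map_mul, Complex.conj_conj]
    linear_combination (-baseDir i α) * h2
  · rw [if_pos (h.2 h'), if_neg h']

theorem altDir_sq (i : ℕ) (α : ℝ) (m : ℕ) :
    altDir i α m ^ 2 = altTurn i α m * glideCoeff i α := by
  have h1 := baseDir_sq i α
  have h1c := congrArg (starRingEnd ℂ) h1
  have h2 := glideCoeff_mul_conj i α
  unfold altDir altTurn
  simp only [map_pow, map_mul] at h1c
  split_ifs
  · rw [mul_pow, h1c]
    linear_combination (glideCoeff i α * (starRingEnd ℂ) (turn α)) * h2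
  · exact h1

/-- The recurrence is real-linear. The condition on e makes the constant e a solution, and `altDir`
times Y is another because `altDir` squares to `altTurn` times `glideCoeff`. -/
theorem fibEnd_eq_of_initial {i : ℕ} (hi : 2 ≤ i) {α : ℝ} {e : ℂ} {Y : ℕ → ℝ}
    (he : e = -(glideCoeff i α * (starRingEnd ℂ) e))
    (hrec : ∀ m, Y (m + 2) = 2 * (1 + Real.cos α) * Y (m + 1) + Y m)
    (h0 : fibEnd i α (baseIndex i 0) = altDir i α 0 * Y 0 + e)
    (h1 : fibEnd i α (baseIndex i 1) = altDir i α 1 * Y 1 + e) (m : ℕ) :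
    fibEnd i α (baseIndex i m) = altDir i α m * Y m + e := by
  induction m using Nat.twoStepInduction with
  | zero => exact h0
  | one => exact h1
  | more m ih0 ih1 =>
    have ha := altTurn_mul_conj i α m
    have hc := altTurn_add_conj i α m
    have hb := altDir_mul_conj i α m
    have hsq := altDir_sq i α m
    have hd := glideCoeff_mul_conj i α
    have hb1 : glideCoeff i α * (starRingEnd ℂ) (altDir i α m) * altTurn i α m = altDir i α m := by
      linear_combination (-(starRingEnd ℂ) (altDir i α m)) * hsq + altDir i α m * hb
    rw [fibEnd_recurrence hi, ih0, ih1, altDir_succ i α (m + 1), altDir_succ i α m, hrec]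
    simp only [map_add, map_mul, Complex.conj_conj, Complex.conj_ofReal, Complex.ofReal_add,
      Complex.ofReal_mul, Complex.ofReal_one, Complex.ofReal_ofNat]
    generalize (starRingEnd ℂ) (altTurn i α m) = a' at *
    generalize altTurn i α m = a at *
    generalize (starRingEnd ℂ) (glideCoeff i α) = d' at *
    generalize glideCoeff i α = d at *
    generalize (starRingEnd ℂ) (altDir i α m) = b' at *
    generalize altDir i α m = b at *
    generalize (starRingEnd ℂ) e = e' at *
    have hb2 : d * b' = b * a' := by linear_combination a' * hb1 - d * b' * ha
    have hb3 : d * (d' * b) = b := by linear_combination b * hd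
    have hc' : 2 * (1 + (Real.cos α : ℂ)) = 2 + a + a' := by linear_combination -hc
    rw [hb3, hc', hb2]
    linear_combination ((2 + a) * b * Y (m + 1)) * ha + (1 + a) * Y m * hb1 +
      ((1 + a) * a) * he

/-- The end points of the curves follow a linear recurrence along an alternating direction, up to
a constant. -/
theorem exists_fibEnd_eq {i : ℕ} (hi : 2 ≤ i) {α : ℝ} (hα : 0 < α) (hα' : α ≤ Real.pi / 2) :
    ∃ (Y : ℕ → ℝ) (e : ℂ), (∀ m, 0 < Y m) ∧
      (∀ m, Y (m + 2) = 2 * (1 + Real.cos α) * Y (m + 1) + Y m) ∧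
      ∀ m, fibEnd i α (baseIndex i m) = altDir i α m * Y m + e := by
  have hc : 0 ≤ Real.cos α := Real.cos_nonneg_of_neg_pi_div_two_le_of_le (by linarith) hα'
  have hc2 : 0 < Real.cos (α / 2) := Real.cos_pos_of_mem_Ioo ⟨by linarith, by linarith⟩
  have hsucc := fibEnd_baseIndex_succ hi α 0
  rcases Nat.even_or_odd i with h | h
  · obtain ⟨j, rfl⟩ : ∃ j, i = 2 * j + 2 := by
      obtain ⟨j, hj⟩ := h
      exact ⟨j - 1, by omega⟩
    have h1 : ¬ Even (2 * j + 2 + 1) := by rw [Nat.even_add_one]; simpa using h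
    have ha := turn_mul_conj α
    have hs := turn_add_conj α
    refine ⟨linRec (1 + Real.cos α) 1 ((j + 1) * (2 + 2 * Real.cos α) + 1), 0,
      linRec_pos (by linarith) one_pos (by positivity), fun m => rfl, ?_⟩
    refine fibEnd_eq_of_initial hi (by simp) (fun m => rfl) ?_ ?_
    · simp only [baseIndex, if_pos h, fibEnd, mul_zero, zero_add, placement_fibWord_one, altDir,
        add_zero, glideCoeff, baseDir_eq, linRec, map_mul, Complex.conj_I, map_zero]
      push_cast
      linear_combination (-Complex.I) * ha
    · rw [hsucc]
      simp only [baseIndex, if_pos h, if_neg h1, fibEnd, mul_zero, zero_add, placement_fibWord_one,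
        altDir, altTurn, placement_fibWord_two_of_even, Nat.reduceAdd,
        add_zero, glideCoeff, baseDir_eq, linRec, map_mul, Complex.conj_I, map_zero, map_add,
        map_one, map_natCast, Complex.conj_conj]
      push_cast at hs ⊢
      linear_combination (Complex.I * turn α * (j + 1)) * hs +
        (j + 1) * Complex.I * (turn α - 1) * ha
  · obtain ⟨j, rfl⟩ := h
    have h : ¬ Even (2 * j + 1) := by simp
    have h1 : Even (2 * j + 1 + 1) := by rw [Nat.even_add_one]; exact h
    have ha := turn_mul_conj α
    have hs := turn_add_conj α
    have hb := turn_mul_conj (α / 2)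
    have hbs := turn_add_conj (α / 2)
    have hsq := turn_half_sq α
    have h3 := placement_fibWord_add_two (2 * j + 1) α (n := 1) le_rfl
    simp only [Nat.reduceAdd] at h3
    have hb0 : turn (α / 2) ≠ 0 := left_ne_zero_of_mul_eq_one hb
    have hbc : (starRingEnd ℂ) (turn (α / 2)) = (turn (α / 2))⁻¹ := eq_inv_of_mul_eq_one_right hb
    rw [hbc] at hbs
    have hcos2 : (Real.cos (α / 2) : ℂ) = (turn (α / 2) + (turn (α / 2))⁻¹) / 2 := by
      rw [hbs]; ring
    have hac : (starRingEnd ℂ) (turn α) = (turn (α / 2) ^ 2)⁻¹ := by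
      rw [← hsq, map_pow, hbc, inv_pow]
    have hcos : (Real.cos α : ℂ) = (turn (α / 2) ^ 2 + (turn (α / 2) ^ 2)⁻¹) / 2 := by
      rw [← hac, hsq, hs]; ring
    -- All quantities become rational functions of b = `turn (α / 2)`; their denominators b and b² +
    -- 1 do not vanish, the latter because cos(α/2) ≠ 0.
    have hne : turn (α / 2) ^ 2 + 1 ≠ 0 := by
      intro h0
      have : (Real.cos (α / 2) : ℂ) * (2 * turn (α / 2)) = 0 := by
        rw [hcos2]
        field_simp
        exact h0
      have hcc : (Real.cos (α / 2) : ℂ) ≠ 0 := by exact_mod_cast hc2.ne'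
      exact hcc ((mul_eq_zero.1 this).resolve_right (by simp [hb0]))
    have hne' : 1 + turn (α / 2) ^ 2 ≠ 0 := by rwa [add_comm]
    -- The constant is -tan(α/2). It is real, as the condition on e requires when `glideCoeff` is
    -- -1.
    refine ⟨linRec (1 + Real.cos α) (2 * j * Real.cos (α / 2) + (Real.cos (α / 2))⁻¹)
      (2 * j * Real.cos (α / 2) * (1 + 2 * Real.cos α) + 4 * Real.cos (α / 2) +
        Real.cos α / Real.cos (α / 2)), Complex.I * (1 - turn α) / (1 + turn α),
      linRec_pos (by linarith) (by positivity) (by positivity), fun m => rfl, ?_⟩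
    refine fibEnd_eq_of_initial hi ?_ (fun m => rfl) ?_ ?_
    · simp only [glideCoeff, if_neg h, map_div₀, map_mul, map_sub, map_add, map_one, Complex.conj_I,
        hac]
      rw [← hsq]
      generalize turn (α / 2) = b at *
      field_simp
      ring
    · simp only [baseIndex, if_neg h, fibEnd, mul_zero, zero_add, placement_fibWord_two_of_odd,
        altDir, add_zero, baseDir_eq, linRec, map_zero]
      push_cast [hcos2]
      rw [← hsq]
      generalize turn (α / 2) = b at *
      field_simp
      ring
    · rw [hsucc]
      simp only [baseIndex, if_neg h, if_pos h1, fibEnd, mul_zero, zero_add, placement_fibWord_one,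
        altDir, altTurn, placement_fibWord_two_of_odd, h3, Nat.reduceAdd,
        add_zero, glideCoeff, baseDir_eq, linRec, map_mul, Complex.conj_I, map_zero, map_add,
        map_sub, map_neg, map_one, map_natCast, hac, hbc]
      push_cast [hcos2, hcos]
      rw [← hsq]
      generalize turn (α / 2) = b at *
      field_simp
      ring

/-! ### Alignment and the decomposition into five pieces -/

/-- The linear isometry `z ↦ c * conj z` for a unit complex number `c`. -/
def conjIsometry (c : ℂ) (hc : ‖c‖ = 1) : ℂ →ₗᵢ[ℝ] ℂ where
  toLinearMap := LinearMap.mulLeft ℝ c ∘ₗ Complex.conjAe.toLinearMap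
  norm_map' z := by simp [hc]

@[simp] theorem conjIsometry_apply (c : ℂ) (hc : ‖c‖ = 1) (z : ℂ) :
    conjIsometry c hc z = c * (starRingEnd ℂ) z := by
  simp [conjIsometry]

theorem norm_glideCoeff (i : ℕ) (α : ℝ) : ‖glideCoeff i α‖ = 1 := by
  unfold glideCoeff
  split_ifs
  · rw [norm_neg]; exact norm_exp_neg_mul_I α
  · simp

/-- The linear part of the glide reflections attached to the words `fibWord i (baseIndex i m)`. -/
def glideLin (i : ℕ) (α : ℝ) : ℂ →ₗᵢ[ℝ] ℂ := conjIsometry (glideCoeff i α) (norm_glideCoeff i α)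

theorem norm_turn_sq_mul_glideCoeff (i : ℕ) (α : ℝ) : ‖turn α ^ 2 * glideCoeff i α‖ = 1 := by
  rw [norm_mul, norm_pow, norm_glideCoeff, turn, norm_exp_neg_mul_I]; norm_num

/-- Reflects every second curve, so that all curves lie on the same side of their chords. -/
def align (i : ℕ) (α : ℝ) (m : ℕ) : ℂ →ₗᵢ[ℝ] ℂ :=
  if Even (i + m) then glideLin i α else LinearIsometry.id

theorem glideLin_glideLin (i : ℕ) (α : ℝ) (z : ℂ) : glideLin i α (glideLin i α z) = z := by
  simp only [glideLin, conjIsometry_apply, map_mul, Complex.conj_conj]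
  linear_combination z * glideCoeff_mul_conj i α

theorem glideLin_baseDir (i : ℕ) (α : ℝ) :
    glideLin i α (baseDir i α) = (starRingEnd ℂ) (turn α) * baseDir i α := by
  simp only [glideLin, conjIsometry_apply]
  linear_combination (-(starRingEnd ℂ) (turn α) * (starRingEnd ℂ) (baseDir i α)) * baseDir_sq i α +
    (starRingEnd ℂ) (turn α) * baseDir i α * baseDir_mul_conj i α -
    (glideCoeff i α * (starRingEnd ℂ) (baseDir i α)) * turn_mul_conj α

theorem align_altDir (i : ℕ) (α : ℝ) (m : ℕ) : align i α m (altDir i α m) = baseDir i α := by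
  unfold align altDir
  split_ifs
  · exact glideLin_glideLin i α (baseDir i α)
  · rfl

/-- The word `fibWord i (baseIndex i (m + 1))` with its two Fibonacci factors exchanged. -/
def swapWord (i m : ℕ) : List (Fin 2) :=
  fibWord i (baseIndex i m + 1) ++ fibWord i (baseIndex i m + 2)

theorem fibWord_baseIndex_add_two (i m : ℕ) :
    fibWord i (baseIndex i (m + 2)) =
      fibWord i (baseIndex i (m + 1)) ++ (fibWord i (baseIndex i (m + 1)) ++
        (fibWord i (baseIndex i m) ++ (swapWord i m ++ swapWord i m))) := by
  have h := fun k => fibWord_add_two i (n := baseIndex i m + k)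
    (le_add_right (one_le_baseIndex i m))
  have h2 := h 0
  have h3 := h 1
  have h4 := h 2
  have h5 := h 3
  have h6 := h 4
  simp only [add_assoc, Nat.reduceAdd, add_zero] at h2 h3 h4 h5 h6
  rw [baseIndex_succ, baseIndex_succ, add_assoc, swapWord, h6, h5, h4, h3, h2]
  simp only [List.append_assoc]

theorem placement_swapWord {i : ℕ} (hi : 2 ≤ i) (α : ℝ) (m : ℕ) (z : ℂ) :
    placement α (swapWord i m) z = placement α (swapWord i m) 0 +
      (starRingEnd ℂ) (altTurn i α m) ^ 2 * glideCoeff i α * (starRingEnd ℂ) z := by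
  have h := placement_baseIndex hi α m
  have h2 := (placement_step h.1 h.2).1
  rw [swapWord, placement_append, Function.comp, Function.comp, h.2, h.2, h2, h2, map_zero]
  ring

theorem iUnion_fin_five {X : Type*} (s : Fin 5 → Set X) :
    ⋃ k, s k = s 0 ∪ (s 1 ∪ (s 2 ∪ (s 3 ∪ s 4))) := by
  ext z
  simp [Set.mem_iUnion, Fin.exists_fin_succ]

/-- The aligned curves. -/
def alignedCurve (i : ℕ) (α : ℝ) (m : ℕ) : Set ℂ :=
  align i α m '' drawCurve α (fibWord i (baseIndex i m))

/-- The end points of the aligned curves. -/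
def alignedEnd (i : ℕ) (α : ℝ) (m : ℕ) : ℂ := align i α m (fibEnd i α (baseIndex i m))

/-- The aligned curves of the words `swapWord i m`. -/
def alignedSwapCurve (i : ℕ) (α : ℝ) (m : ℕ) : Set ℂ :=
  align i α (m + 1) '' drawCurve α (swapWord i m)

/-- The end points of the aligned curves of the words `swapWord i m`. -/
def alignedSwapEnd (i : ℕ) (α : ℝ) (m : ℕ) : ℂ :=
  align i α (m + 1) (placement α (swapWord i m) 0)

/-- Linear parts of the five pieces of an aligned curve. -/
def pieceLin (i : ℕ) (α : ℝ) : Fin 5 → (ℂ →ₗᵢ[ℝ] ℂ) :=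
  ![glideLin i α, LinearIsometry.id, LinearIsometry.id, LinearIsometry.id,
    conjIsometry (turn α ^ 2 * glideCoeff i α) (norm_turn_sq_mul_glideCoeff i α)]

/-- Starting points of the five pieces of an aligned curve. -/
def pieceStart (i : ℕ) (α : ℝ) (k : Fin 5) (m : ℕ) : ℂ :=
  let u := alignedEnd i α (m + 1)
  ![0, glideLin i α u, glideLin i α u + u, glideLin i α u + u + alignedEnd i α m,
    glideLin i α u + u + alignedEnd i α m + alignedSwapEnd i α m] k

/-- The five pieces of an aligned curve, before they are moved to their positions. -/
def pieceCurve (i : ℕ) (α : ℝ) (k : Fin 5) (m : ℕ) : Set ℂ :=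
  ![alignedCurve i α (m + 1), alignedCurve i α (m + 1), alignedCurve i α m,
    alignedSwapCurve i α m, alignedSwapCurve i α m] k

/-- Exactly one of two consecutive alignments is the reflection `glideLin`. This absorbs the
alternation, so the linear parts of the pieces do not depend on m. -/
theorem alignedCurve_add_two {i : ℕ} (hi : 2 ≤ i) (α : ℝ) (m : ℕ) :
    alignedCurve i α (m + 2) =
      ⋃ k, (fun z => pieceStart i α k m + pieceLin i α k z) '' pieceCurve i α k m := by
  have hA0 := (placement_baseIndex hi α m).1
  have hA1 := (placement_baseIndex hi α (m + 1)).1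
  have hA' := placement_swapWord hi α m
  have hd := glideCoeff_mul_conj i α
  have ha := turn_mul_conj α
  have hm1 : Even (i + (m + 1)) ↔ ¬ Even (i + m) := Nat.even_add_one
  have hm2 : Even (i + (m + 2)) ↔ Even (i + m) := by
    rw [← add_assoc, Nat.even_add_one, not_iff_comm]; exact hm1.symm
  rw [alignedCurve, fibWord_baseIndex_add_two, iUnion_fin_five]
  simp only [drawCurve_append, Set.image_union, Set.image_image, hA0, hA1, pieceStart, pieceLin,
    pieceCurve, Matrix.cons_val, alignedCurve, alignedSwapCurve, alignedEnd, alignedSwapEnd]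
  generalize placement α (swapWord i m) 0 = v' at *
  simp only [hA']
  generalize fibEnd i α (baseIndex i m) = v
  generalize fibEnd i α (baseIndex i (m + 1)) = v1
  have hd0 : glideCoeff i α ≠ 0 := left_ne_zero_of_mul_eq_one hd
  have ha0 : turn α ≠ 0 := left_ne_zero_of_mul_eq_one ha
  have hd' := eq_inv_of_mul_eq_one_right hd
  have ha' := eq_inv_of_mul_eq_one_right ha
  by_cases h : Even (i + m)
  · simp only [align, if_pos h, if_pos (hm2.2 h), if_neg (fun h' => hm1.1 h' h), glideLin,
      LinearIsometry.id_apply, conjIsometry_apply, altTurn, map_add, map_mul, map_pow,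
      Complex.conj_conj, hd', ha', map_inv₀]
    generalize glideCoeff i α = d at *
    generalize turn α = a at *
    refine congrArg₂ _ ?_ (congrArg₂ _ ?_ (congrArg₂ _ ?_ (congrArg₂ _ ?_ ?_))) <;>
      refine Set.image_congr fun z _ => ?_
    all_goals
      field_simp
      try ring
  · simp only [align, if_neg h, if_neg (fun h' => h (hm2.1 h')), if_pos (hm1.2 h), glideLin,
      LinearIsometry.id_apply, conjIsometry_apply, altTurn, map_add, map_mul, map_pow,
      Complex.conj_conj, hd', ha', map_inv₀]
    generalize glideCoeff i α = d at *
    generalize turn α = a at *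
    refine congrArg₂ _ ?_ (congrArg₂ _ ?_ (congrArg₂ _ ?_ (congrArg₂ _ ?_ ?_))) <;>
      refine Set.image_congr fun z _ => ?_
    · change z = _
      field_simp
      ring
    all_goals
      field_simp
      try ring

/-! ### Limits of the starting points of the pieces -/

theorem norm_alignedEnd_sub_le {i : ℕ} {α : ℝ} {Y : ℕ → ℝ} {e : ℂ} {m : ℕ}
    (h : fibEnd i α (baseIndex i m) = altDir i α m * Y m + e) :
    ‖alignedEnd i α m - Y m * baseDir i α‖ ≤ ‖e‖ := by
  have : alignedEnd i α m - Y m * baseDir i α = align i α m e := by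
    rw [alignedEnd, h, map_add, mul_comm, ← Complex.real_smul, map_smul, align_altDir,
      Complex.real_smul]
    ring
  rw [this, LinearIsometry.norm_map]

theorem tendsto_scaled_of_norm_sub_le {Y : ℕ → ℝ} (hinv : Tendsto (fun m => (Y m)⁻¹) atTop (𝓝 0))
    {j : ℕ} {ρ C κ : ℝ} (hρ : Tendsto (fun m => Y (m + j) / Y (m + 2)) atTop (𝓝 ρ))
    {u : ℕ → ℂ} {b : ℂ} (hu : ∀ m, ‖u m - Y (m + j) * b‖ ≤ C) :
    Tendsto (fun m => ((κ / Y (m + 2) : ℝ) : ℂ) * u m) atTop (𝓝 (κ * b * ρ)) := by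
  have h1 : Tendsto (fun m => (κ : ℂ) * b * ((Y (m + j) / Y (m + 2) : ℝ) : ℂ)) atTop
      (𝓝 (κ * b * ρ)) :=
    ((Complex.continuous_ofReal.tendsto _).comp hρ).const_mul _
  have h2 : Tendsto (fun m => ((κ * (Y (m + 2))⁻¹ : ℝ) : ℂ) * (u m - Y (m + j) * b)) atTop
      (𝓝 0) := by
    have h3 : Tendsto (fun m => |κ| * |(Y (m + 2))⁻¹| * C) atTop (𝓝 (|κ| * |0| * C)) :=
      (((hinv.comp (tendsto_add_atTop_nat 2)).abs).const_mul _).mul_const _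
    rw [abs_zero, mul_zero, zero_mul] at h3
    refine squeeze_zero_norm (fun m => ?_) h3
    rw [norm_mul, Complex.norm_real, Real.norm_eq_abs, abs_mul]
    exact mul_le_mul_of_nonneg_left (hu m) (by positivity)
  have h4 := h1.add h2
  rw [add_zero] at h4
  refine h4.congr fun m => ?_
  push_cast
  ring

theorem glideLin_largeBase (i : ℕ) (α : ℝ) :
    glideLin i α (largeBase i α) = Complex.exp (α * Complex.I) * largeBase i α := by
  rw [largeBase, ← Complex.real_smul, map_smul, glideLin_baseDir, conj_turn]
  simp only [Complex.real_smul]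
  ring

theorem fibMap_baseReflection (i : ℕ) (α : ℝ) (k : Fin 5) (z : ℂ) :
    fibMap i α k (baseReflection i α z) = baseEnd i α k - fibCoeff α k *
      Complex.exp (-(α : ℂ) * Complex.I) * glideLin i α z := by
  have hs := largeBase_ne_zero i α
  have h := glideLin_largeBase i α
  have ha := turn_mul_conj α
  rw [conj_turn, turn] at ha
  simp only [glideLin, conjIsometry_apply] at h ⊢
  have hsc : (starRingEnd ℂ) (largeBase i α) ≠ 0 := by simpa using hs
  have key : largeBase i α * (starRingEnd ℂ) (z / largeBase i α) =
      Complex.exp (-(α : ℂ) * Complex.I) * (glideCoeff i α * (starRingEnd ℂ) z) := by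
    rw [map_div₀, mul_div_assoc', div_eq_iff hsc]
    linear_combination (-(starRingEnd ℂ) z * Complex.exp (-(α : ℂ) * Complex.I)) * h -
      ((starRingEnd ℂ) z * largeBase i α) * ha
  rw [fibMap, baseEnd_eq, baseReflection, mul_sub, mul_one, key]
  ring

/-- A piece of the curve of index `m + 2` is a copy of the curve of index `m + pieceLag k`. -/
def pieceLag : Fin 5 → Fin 2 := ![1, 1, 0, 1, 1]

/-- The limits of the rescaled starting points of the pieces. -/
def limitStart (i : ℕ) (α : ℝ) : Fin 5 → ℂ :=
  ![0, pathVertex i α 1, pathVertex i α 2, pathVertex i α 3, pathVertex i α 4]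

/-- The curve runs along the path from 0, but the first and the last small base are directed against
it. For these two the mirror symmetry of F replaces `fibMap` by an orientation-reversing map based
at the other end. -/
theorem IsAttractor.eq_iUnion_pieces {i : ℕ} {α : ℝ} (hc : 0 ≤ Real.cos α) {F : Set ℂ}
    (hF : IsAttractor (fibMap i α) F) :
    F = ⋃ k, (fun z => limitStart i α k +
      ((ratioR α ^ (2 - (pieceLag k : ℕ)) : ℝ) : ℂ) * pieceLin i α k z) '' F := by
  conv_lhs => rw [hF.2.2]
  have hσ := hF.image_baseReflection hc
  have ha := turn_mul_conj α
  rw [conj_turn] at ha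
  have hlag : 2 - ((1 : Fin 2) : ℕ) = 1 := rfl
  refine Set.iUnion_congr fun k => ?_
  have hflip : fibMap i α k '' F = (fun z => baseEnd i α k - fibCoeff α k *
      Complex.exp (-(α : ℂ) * Complex.I) * glideLin i α z) '' F := by
    conv_lhs => rw [← hσ, Set.image_image]
    simp only [fibMap_baseReflection]
  fin_cases k
  · rw [hflip]
    refine Set.image_congr fun z _ => ?_
    simp only [Fin.zero_eta, baseEnd, limitStart, pieceLin, pieceLag, fibCoeff, Matrix.cons_val,
      pathVertex, ← turn.eq_1]
    rw [hlag, pow_one]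
    linear_combination (ratioR α * glideLin i α z) * ha
  · refine Set.image_congr fun z _ => ?_
    simp [fibMap, baseStart, limitStart, pieceLin, pieceLag, fibCoeff]
  · refine Set.image_congr fun z _ => ?_
    simp [fibMap, baseStart, limitStart, pieceLin, pieceLag, fibCoeff]
  · refine Set.image_congr fun z _ => ?_
    simp [fibMap, baseStart, limitStart, pieceLin, pieceLag, fibCoeff]
  · rw [hflip]
    refine Set.image_congr fun z _ => ?_
    simp only [Fin.reduceFinMk, baseEnd, limitStart, pieceLin, pieceLag, fibCoeff, Matrix.cons_val,
      ← turn.eq_1, glideLin, conjIsometry_apply]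
    rw [hlag, pow_one]
    ring

theorem tendsto_pieceStart {i : ℕ} {α : ℝ} {Y : ℕ → ℝ} (hα' : 0 ≤ Real.cos α)
    (hY : ∀ m, 0 < Y m) (hrec : ∀ m, Y (m + 2) = 2 * (1 + Real.cos α) * Y (m + 1) + Y m)
    {e : ℂ} (he : ∀ m, fibEnd i α (baseIndex i m) = altDir i α m * Y m + e) {M : ℝ}
    (hM : ∀ m, ‖alignedSwapEnd i α m - alignedEnd i α (m + 1)‖ ≤ M) (k : Fin 5) :
    Tendsto (fun m => ((Real.sqrt 2 / Y (m + 2) : ℝ) : ℂ) * pieceStart i α k m) atTop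
      (𝓝 (limitStart i α k)) := by
  have ht : 1 ≤ 1 + Real.cos α := by linarith
  have hinv := tendsto_inv_of_recurrence ht ratioR_pos (ratioR_eq α) hY hrec
  have h1 : Tendsto (fun m => Y (m + 1) / Y (m + 2)) atTop (𝓝 (ratioR α)) :=
    (tendsto_ratio_of_recurrence ht ratioR_pos (ratioR_eq α) hY hrec).comp (tendsto_add_atTop_nat 1)
  have h2 : Tendsto (fun m => Y (m + 0) / Y (m + 2)) atTop (𝓝 (ratioR α ^ 2)) :=
    tendsto_ratio_two_of_recurrence ht ratioR_pos (ratioR_eq α) hY hrec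
  have hu0 := tendsto_scaled_of_norm_sub_le (κ := Real.sqrt 2) hinv h2
    (fun m => norm_alignedEnd_sub_le (he m))
  have hu1 := tendsto_scaled_of_norm_sub_le (κ := Real.sqrt 2) hinv h1
    (fun m => norm_alignedEnd_sub_le (he (m + 1)))
  have hu' := tendsto_scaled_of_norm_sub_le (κ := Real.sqrt 2) hinv h1
    (u := alignedSwapEnd i α) (b := baseDir i α) (C := M + ‖e‖) fun m => by
      have := norm_add_le (alignedSwapEnd i α m - alignedEnd i α (m + 1))
        (alignedEnd i α (m + 1) - Y (m + 1) * baseDir i α)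
      rw [sub_add_sub_cancel] at this
      exact this.trans (add_le_add (hM m) (norm_alignedEnd_sub_le (he (m + 1))))
  rw [← largeBase] at hu0 hu1 hu'
  have hω := ((glideLin i α).continuous.tendsto _).comp hu1
  have hlin : ∀ (r : ℝ) (z : ℂ), glideLin i α ((r : ℂ) * z) = (r : ℂ) * glideLin i α z := by
    intro r z
    rw [← Complex.real_smul, map_smul, Complex.real_smul]
  have hlim : glideLin i α (largeBase i α * ratioR α) = pathVertex i α 1 := by
    rw [mul_comm, hlin, glideLin_largeBase]
    simp only [pathVertex, Matrix.cons_val, largeBase]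
    ring
  rw [hlim] at hω
  simp only [Function.comp_def, hlin] at hω
  have e2 : pathVertex i α 2 = pathVertex i α 1 + largeBase i α * ratioR α := by
    simp only [pathVertex, Matrix.cons_val, largeBase]; ring
  have e3 : pathVertex i α 3 = pathVertex i α 2 + largeBase i α * (ratioR α ^ 2 : ℝ) := by
    simp only [pathVertex, Matrix.cons_val, largeBase]; push_cast; ring
  have e4 : pathVertex i α 4 = pathVertex i α 3 + largeBase i α * ratioR α := by
    simp only [pathVertex, Matrix.cons_val, largeBase]; ring
  have p2 := hω.add hu1
  have p3 := p2.add hu0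
  have p4 := p3.add hu'
  rw [← e2] at p2 p3 p4
  rw [← e3] at p3 p4
  rw [← e4] at p4
  fin_cases k
  · simp [pieceStart, limitStart]
  · simpa [pieceStart, limitStart] using hω
  · simpa [pieceStart, limitStart, mul_add] using p2
  · simpa [pieceStart, limitStart, mul_add] using p3
  · simpa [pieceStart, limitStart, mul_add] using p4

theorem exists_alignedSwap_close (i : ℕ) (α : ℝ) :
    ∃ M : ℝ, 0 ≤ M ∧ ∀ m, HausdorffClose M (alignedSwapCurve i α m) (alignedCurve i α (m + 1)) ∧
      ‖alignedSwapEnd i α m - alignedEnd i α (m + 1)‖ ≤ M := by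
  obtain ⟨M, hM0, hM⟩ := exists_hausdorffClose_swap i α
  refine ⟨M, hM0, fun m => ?_⟩
  obtain ⟨h1, h2⟩ := hM (baseIndex i m + 1) (by omega)
  have e : fibWord i (baseIndex i (m + 1)) =
      fibWord i (baseIndex i m + 2) ++ fibWord i (baseIndex i m + 1) := by
    rw [baseIndex_succ]
    exact fibWord_add_two i (show 1 ≤ baseIndex i m + 1 by omega)
  constructor
  · rw [alignedSwapCurve, alignedCurve, e, swapWord]
    simpa using h1.image zero_le_one fun x y => by
      rw [one_mul]; exact ((align i α (m + 1)).isometry.dist_eq x y).le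
  · rw [alignedSwapEnd, alignedEnd, ← map_sub, LinearIsometry.norm_map, fibEnd, e, swapWord,
      ← Complex.dist_eq]
    exact h2

/-! ### The scaling limit -/

/-- The subsequence picks out the base indices at which `align` is the identity, so there the
aligned curve is the curve itself. -/
theorem exists_fibIndex_eq (i k : ℕ) :
    ∃ m, k ≤ m ∧ fibIndex i k = baseIndex i m ∧ ¬ Even (i + m) := by
  unfold fibIndex baseIndex
  by_cases h : Even i
  · refine ⟨2 * k + 1, by omega, by simp only [if_pos h]; ring, ?_⟩
    rw [Nat.even_add]
    simp [h]
  · refine ⟨2 * k, by omega, by simp only [if_neg h]; ring, ?_⟩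
    rw [Nat.even_add]
    simp [h]

theorem IsAttractor.isScalingLimit {i : ℕ} (hi : 2 ≤ i) {α : ℝ} (hα : 0 < α)
    (hα' : α ≤ Real.pi / 2) {F : Set ℂ} (hF : IsAttractor (fibMap i α) F) :
    IsScalingLimit i α F := by
  have hc : 0 ≤ Real.cos α := Real.cos_nonneg_of_neg_pi_div_two_le_of_le (by linarith) hα'
  have ht : 1 ≤ 1 + Real.cos α := by linarith
  have hκ : 0 < Real.sqrt 2 := by positivity
  obtain ⟨Y, e, hY, hrec, he⟩ := exists_fibEnd_eq hi hα hα'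
  obtain ⟨M, hM0, hM⟩ := exists_alignedSwap_close i α
  obtain ⟨B, hB0, hB⟩ := hF.2.1.isBounded.exists_pos_norm_le
  obtain ⟨ε, hε, hclose⟩ := exists_hausdorffClose_tendsto_zero ht ratioR_pos (ratioR_eq α) hY hrec
    hκ (K := alignedCurve i α)
    (fun m => (drawCurve_nonempty α (fibWord_ne_nil i (one_le_baseIndex i m))).image _)
    (fun m => (isCompact_drawCurve α _).image (align i α m).continuous)
    (S := pieceCurve i α) (lag := pieceLag) hM0
    (fun k m => by
      fin_cases k
      · exact (HausdorffClose.refl _).mono hM0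
      · exact (HausdorffClose.refl _).mono hM0
      · exact (HausdorffClose.refl _).mono hM0
      · exact (hM m).1
      · exact (hM m).1)
    (pieceLin i α) (alignedCurve_add_two hi α)
    (tendsto_pieceStart hc hY hrec he fun m => (hM m).2) hF.1 hF.2.1 (hF.eq_iUnion_pieces hc)
  refine ⟨hF.1, hF.2.1, ?_⟩
  choose m hm hidx hodd using exists_fibIndex_eq i
  have hmt : Tendsto m atTop atTop := tendsto_atTop_mono hm tendsto_id
  have hinv := tendsto_inv_of_recurrence ht ratioR_pos (ratioR_eq α) hY hrec
  -- The true width differs from Y by at most ‖e‖, so the two normalisations are asymptotically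
  -- equal.
  let w : ℕ → ℝ := fun n => ‖fibEnd i α (baseIndex i n)‖
  have hwY : Tendsto (fun n => w n * (Y n)⁻¹) atTop (𝓝 1) := by
    have h0 : Tendsto (fun n => ‖e‖ * (Y n)⁻¹) atTop (𝓝 0) := by simpa using hinv.const_mul ‖e‖
    rw [tendsto_iff_dist_tendsto_zero]
    refine squeeze_zero (fun _ => dist_nonneg) (fun n => ?_) h0
    have h1 : ‖altDir i α n * Y n‖ = Y n := by
      have := congrArg norm (altDir_mul_conj i α n)
      rw [norm_mul, Complex.norm_conj, norm_one] at this
      have h2 : ‖altDir i α n‖ = 1 := by nlinarith [norm_nonneg (altDir i α n)]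
      rw [norm_mul, h2, Complex.norm_real, Real.norm_eq_abs, abs_of_pos (hY n), one_mul]
    have h3 : |w n - Y n| ≤ ‖e‖ := by
      have := abs_norm_sub_norm_le (fibEnd i α (baseIndex i n)) (altDir i α n * Y n)
      rwa [h1, he n, add_sub_cancel_left, ← he n] at this
    have h4 : w n * (Y n)⁻¹ - 1 = (w n - Y n) * (Y n)⁻¹ := by
      rw [sub_mul, mul_inv_cancel₀ (hY n).ne']
    rw [Real.dist_eq, h4, abs_mul, abs_of_pos (inv_pos.2 (hY n))]
    exact mul_le_mul_of_nonneg_right h3 (inv_pos.2 (hY n)).le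
  have hYw : Tendsto (fun n => Y n / w n) atTop (𝓝 1) := by
    have := hwY.inv₀ one_ne_zero
    rw [inv_one] at this
    refine this.congr fun n => ?_
    rw [mul_inv, inv_inv, mul_comm, div_eq_mul_inv]
  have hwpos : ∀ᶠ n in atTop, 0 < w n := by
    filter_upwards [hwY.eventually_const_lt one_pos] with n hn
    by_contra h
    have : w n = 0 := le_antisymm (not_lt.1 h) (norm_nonneg _)
    simp [this] at hn
  have hbound : Tendsto (fun n => Y n / w n * ε n + |Y n / w n - 1| * B) atTop (𝓝 0) := by
    have := (hYw.mul hε).add (((hYw.sub_const 1).abs).mul_const B)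
    simpa using this
  have hfinal : Tendsto (fun k => ENNReal.ofReal
      (Y (m k) / w (m k) * ε (m k) + |Y (m k) / w (m k) - 1| * B)) atTop (𝓝 0) := by
    have := (ENNReal.continuous_ofReal.tendsto 0).comp (hbound.comp hmt)
    simpa [Function.comp_def] using this
  refine tendsto_of_tendsto_of_tendsto_of_le_of_le' tendsto_const_nhds hfinal
    (Eventually.of_forall fun _ => zero_le) ?_
  filter_upwards [hmt.eventually hwpos] with k hk
  refine HausdorffClose.hausdorffEDist_le ?_
  have hK : alignedCurve i α (m k) = drawCurve α (fibWord i (baseIndex i (m k))) := by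
    rw [alignedCurve, align, if_neg (hodd k)]
    simp
  -- Changing the scale from √2/Y to √2/w is a single piece with no displacement and limiting ratio
  -- 1.
  have hsc := (hclose (m k)).scaled_piece (div_pos hκ (hY (m k))) (div_pos hκ hk)
    LinearIsometry.id 0 0 (l := 1) hB
  have hr : Real.sqrt 2 / w (m k) / (Real.sqrt 2 / Y (m k)) = Y (m k) / w (m k) := by
    have := (hY (m k)).ne'
    field_simp
  rw [hr, hK] at hsc
  have hset : scaledCurve α (fibWord i (fibIndex i k)) =
      (fun z : ℂ => ((Real.sqrt 2 / w (m k) : ℝ) : ℂ) * z) ''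
        drawCurve α (fibWord i (baseIndex i (m k))) := by
    rw [scaledCurve, drawWidth_eq, hidx]
    rfl
  rw [hset]
  simpa using hsc

theorem theorem5p6 (i : ℕ) (hi : 2 ≤ i) (α : ℝ) (hα : 0 < α) (hα' : α ≤ Real.pi / 2) :
    IsTrapezoidIFS i α (fibMap i α) ∧
    ∃ F : Set ℂ, IsScalingLimit i α F ∧
      ∀ φ : Fin 5 → ℂ → ℂ, IsTrapezoidIFS i α φ →
        IsAttractor φ F ∧ ∀ G : Set ℂ, IsAttractor φ G → G = F := by
  have hc : 0 ≤ Real.cos α := Real.cos_nonneg_of_neg_pi_div_two_le_of_le (by linarith) hα'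
  obtain ⟨F, hF⟩ := exists_isAttractor (isContractiveSimilarity_fibMap i hc)
  refine ⟨isTrapezoidIFS_fibMap i hc, F, hF.isScalingLimit hi hα hα', fun φ hφ => ?_⟩
  have hFφ := hφ.isAttractor hα hα' hF
  exact ⟨hFφ, fun G hG => hFφ.unique (fun k => (hφ k).1) hG⟩

end
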